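/- Let $\mathbb{D}=\{z\in\mathbb{C}:|z|<1\}$. For $1\le p<\infty$ and $f$ holomorphic in $\mathbb{D}$ put $$\|f\|_{H^p}=\sup_{0\le\rho<1}\Big(\frac1{2\pi}\int_0^{2\pi}|f(\rho e^{i\theta})|^p\,d\theta\Big)^{1/p},$$ and, for $\beta>-1$, $$\|f\|_{A^p(\beta)}=\Big(\int_{\mathbb{D}}|f(z)|^p(1-|z|^2)^\beta\,d\mathcal{A}(z)\Big)^{1/p},$$ where $\mathcal{A}$ is the area measure normalized so that $\mathcal{A}(\mathbb{D})=1$. For $\sigma=(\lambda_1,\dots,\lambda_n)\in\mathbb{D}^n$ let $P_\sigma(z)=\prod_{i=1}^n(z-\lambda_i)$, and for $f$ holomorphic in $\mathbb{D}$ define $$\mathcal{M}(f,\sigma)=\sup\{\|f(T)\| : T\in\mathbb{C}^{n\times n},\ \|T\|\le1,\ m_T=P_\sigma\},$$ where $\|\cdot\|$ is the operator norm induced by the Euclidean (Hilbert) norm on $\mathbb{C}^n$, $m_T$ is the minimal polynomial of $T$, and $f(T)=\sum_{k\ge0}\frac{f^{(k)}(0)}{k!}T^k$ (the series converges since the spectrum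 of $T$ lies in $\mathbb{D}$). (1) For every $p\in[1,\infty)$ there are constants $a,b>0$ depending only on $p$ such that for all integers $n\ge1$ and all $r\in[0,1)$ $$a\Big(\frac{n}{1-r}\Big)^{1/p}\le\sup\big\{\mathcal{M}(f,\sigma): f \text{ holomorphic in }\mathbb{D},\ \|f\|_{H^p}\le1,\ \sigma\in\mathbb{D}^n,\ \max_{\lambda\in\sigma}|\lambda|\le r\big\}\le b\Big(\frac{n}{1-r}\Big)^{1/p}.$$ (2) For every $p\in[1,\infty)$ and $\beta>-1$ there are constants $a,b>0$ depending only on $p$ and $\beta$ such that for all integers $n\ge1$ and all $r\in[0,1)$ $$a\Big(\frac{n}{1-r}\Big)^{(2+\beta)/p}\le\sup\big\{\mathcal{M}(f,\sigma): f \text{ holomorphic in }\mathbb{D},\ \|f\|_{A^p(\beta)}\le1,\ \sigma\in\mathbb{D}^n,\ \max_{\lambda\in\sigma}|\lambda|\le r\big\}\le b\Big(\frac{n}{1-r}\Big)^{(2+\beta)/p}.$$ -/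

import Mathlib

open scoped ENNReal

noncomputable section

namespace PtakYoung

/-- `‖f‖_{H^p}`: the supremum over `0 ≤ ρ < 1` of the `L^p` means of `f` over the circles
`|z| = ρ`, with respect to normalized arc length; `∞` if `f ∉ H^p`. -/
def hardyNorm (p : ℝ) (f : ℂ → ℂ) : ℝ≥0∞ :=
  ⨆ ρ ∈ Set.Ico (0 : ℝ) 1,
    ((ENNReal.ofReal (2 * Real.pi))⁻¹ *
      ∫⁻ θ in Set.Ioc 0 (2 * Real.pi), ‖f (circleMap 0 ρ θ)‖ₑ ^ p) ^ (1 / p)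

/-- `‖f‖_{A^p(β)}`: the `L^p` norm of `f` over the unit disc with weight `(1 - |z|²)^β`, with
respect to normalized area measure; `∞` if `f ∉ A^p(β)`. -/
def bergmanNorm (p β : ℝ) (f : ℂ → ℂ) : ℝ≥0∞ :=
  ((ENNReal.ofReal Real.pi)⁻¹ *
    ∫⁻ z in Metric.ball (0 : ℂ) 1,
      ‖f z‖ₑ ^ p * ENNReal.ofReal ((1 - ‖z‖ ^ 2) ^ β)) ^ (1 / p)

/-- `f(T) = ∑ₖ f̂(k) Tᵏ`, with `f̂(k)` the Taylor coefficients of `f` at `0`. For `f` holomorphic in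
the unit disc and a matrix `T` with spectrum in the unit disc the series converges. -/
def funcCalc {n : ℕ} (f : ℂ → ℂ) (T : Matrix (Fin n) (Fin n) ℂ) : Matrix (Fin n) (Fin n) ℂ :=
  ∑' k : ℕ, (iteratedDeriv k f 0 / (k.factorial : ℂ)) • T ^ k

/-- `P_σ`, the monic polynomial whose zeros, with multiplicities, are the terms of `σ`. -/
def monicPoly {n : ℕ} (σ : Fin n → ℂ) : Polynomial ℂ :=
  ∏ i, (Polynomial.X - Polynomial.C (σ i))

open scoped Matrix.Norms.L2Operator in
/-- `𝓜(f, σ)`: the supremum of `‖f(T)‖` over `n × n` contractions `T` with minimal polynomial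
`P_σ`. Here `‖·‖` is the operator norm for the Hilbert norm on `ℂⁿ`. -/
def ptakYoung {n : ℕ} (f : ℂ → ℂ) (σ : Fin n → ℂ) : ℝ≥0∞ :=
  ⨆ (T : Matrix (Fin n) (Fin n) ℂ) (_ : ‖T‖ ≤ 1) (_ : minpoly ℂ T = monicPoly σ),
    ‖funcCalc f T‖ₑ

/-- The supremum of `𝓜(f, σ)` over the functions `f` holomorphic in the unit disc with `N f ≤ 1`
and the sequences `σ` of length `n` in the unit disc with `max |λ| ≤ r`. -/
def supPtakYoung (N : (ℂ → ℂ) → ℝ≥0∞) (n : ℕ) (r : ℝ) : ℝ≥0∞ :=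
  ⨆ (f : ℂ → ℂ) (_ : DifferentiableOn ℂ f (Metric.ball 0 1)) (_ : N f ≤ 1)
    (σ : Fin n → ℂ) (_ : ∀ i, σ i ∈ Metric.ball (0 : ℂ) 1) (_ : ∀ i, ‖σ i‖ ≤ r),
    ptakYoung f σ

end PtakYoung

end

/-!
Upper bound. Put `N = n / (1 - r)`. Splitting off the Blaschke factors of `m_T` one at a time gives
`∑ₖ ‖Tᵏ x‖² ≤ 2 N ‖x‖²`, so `Tᴷ` halves squared norms for some `K` comparable to `N`. By Rota's
construction `T` is then similar, with condition number at most `√2`, to an operator `S` of norm at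
most `1 - 1 / (8 K)`. Writing `f(S)` as a Poisson integral, Jensen's inequality yields
`‖f(T)‖ᵖ ≤ C N · (mean of |f|ᵖ over |z| = ρ)` for all `ρ` close enough to `1`: the Hardy norm bounds
one such mean, the Bergman norm the weighted integral of the means over `1 - 1 / (80 N) ≤ ρ < 1`.

Lower bound. Let `T` be the image of the nilpotent shift under the disc automorphism
`z ↦ (z + r) / (1 + r z)`, and `f(z) = c / (1 - ρ z)ᵐ⁺¹` with `1 - ρ = 1 / (4 N)`. Then `f(T)` is
the Toeplitz matrix of a power series whose `k`-th coefficient is at least of order `kᵐ` for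
`k < n`, and testing it on the vector `(1, …, 1)` gives `‖f(T)‖ ≥ C c Nᵐ⁺¹`.
-/

open scoped ENNReal ComplexConjugate InnerProductSpace
open Polynomial MeasureTheory

noncomputable section

namespace PtakYoung

section Operator

variable {E : Type*} [NormedAddCommGroup E] [InnerProductSpace ℂ E]

lemma norm_sub_conj_smul_sq (c : ℂ) (z w : E) :
    ‖z - conj c • w‖ ^ 2 = ‖w - c • z‖ ^ 2 + (1 - ‖c‖ ^ 2) * (‖z‖ ^ 2 - ‖w‖ ^ 2) := by
  have hz := norm_sub_sq (𝕜 := ℂ) z (conj c • w)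
  have hw := norm_sub_sq (𝕜 := ℂ) w (c • z)
  rw [inner_smul_right, norm_smul, RCLike.norm_conj] at hz
  rw [inner_smul_right, norm_smul] at hw
  have hcross : RCLike.re (conj c * ⟪z, w⟫_ℂ) = RCLike.re (c * ⟪w, z⟫_ℂ) := by
    rw [← inner_conj_symm z w, ← map_mul, RCLike.conj_re]
  rw [hz, hw, hcross]
  ring

variable {T : E →L[ℂ] E}

lemma norm_apply_le_of_norm_le_one (hT : ‖T‖ ≤ 1) (x : E) : ‖T x‖ ≤ ‖x‖ := by
  simpa using T.le_of_opNorm_le hT x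

lemma norm_apply_sub_smul_le (hT : ‖T‖ ≤ 1) {c : ℂ} (hc : ‖c‖ ≤ 1) (z : E) :
    ‖T z - c • z‖ ≤ ‖z - conj c • T z‖ := by
  have hTz : ‖T z‖ ^ 2 ≤ ‖z‖ ^ 2 := by gcongr; exact norm_apply_le_of_norm_le_one hT z
  have hc2 : ‖c‖ ^ 2 ≤ 1 := pow_le_one₀ (norm_nonneg c) hc
  refine le_of_sq_le_sq ?_ (norm_nonneg _)
  rw [norm_sub_conj_smul_sq]
  exact le_add_of_nonneg_right (mul_nonneg (by linarith) (by linarith))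

lemma one_sub_norm_mul_norm_le (hT : ‖T‖ ≤ 1) (c : ℂ) (z : E) :
    (1 - ‖c‖) * ‖z‖ ≤ ‖z - conj c • T z‖ := by
  have hTz : ‖conj c • T z‖ ≤ ‖c‖ * ‖z‖ := by
    rw [norm_smul, RCLike.norm_conj]
    gcongr
    exact norm_apply_le_of_norm_le_one hT z
  linarith [norm_sub_norm_le z (conj c • T z)]

lemma sum_norm_pow_apply_sq_le_add {c : ℂ} (hc : ‖c‖ ≤ 1) (K : ℕ) (z : E) :
    ∑ k ∈ Finset.range K, ‖(T ^ k) (z - conj c • T z)‖ ^ 2 ≤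
      ∑ k ∈ Finset.range K, ‖(T ^ k) (T z - c • z)‖ ^ 2 + (1 - ‖c‖ ^ 2) * ‖z‖ ^ 2 := by
  have hc2 : 0 ≤ 1 - ‖c‖ ^ 2 := sub_nonneg.2 (pow_le_one₀ (norm_nonneg c) hc)
  have hterm (k : ℕ) : ‖(T ^ k) (z - conj c • T z)‖ ^ 2 = ‖(T ^ k) (T z - c • z)‖ ^ 2 +
      (1 - ‖c‖ ^ 2) * (‖(T ^ k) z‖ ^ 2 - ‖(T ^ (k + 1)) z‖ ^ 2) := by
    have hTk : (T ^ k) (T z) = (T ^ (k + 1)) z := by rw [pow_succ, mul_apply_eq_comp]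
    rw [map_sub, map_smul, map_sub, map_smul, hTk, norm_sub_conj_smul_sq]
  rw [Finset.sum_congr rfl fun k _ => hterm k, Finset.sum_add_distrib, ← Finset.mul_sum,
    Finset.sum_range_sub' fun k => ‖(T ^ k) z‖ ^ 2, pow_zero, one_apply_eq_self]
  gcongr
  exact sub_le_self _ (sq_nonneg _)

lemma antitone_norm_pow_apply (hT : ‖T‖ ≤ 1) (x : E) : Antitone fun k : ℕ => ‖(T ^ k) x‖ :=
  antitone_nat_of_succ_le fun k => by
    rw [pow_succ', mul_apply_eq_comp]
    exact norm_apply_le_of_norm_le_one hT _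

lemma norm_pow_apply_sq_le_half (hT : ‖T‖ ≤ 1) {M : ℝ} {K : ℕ} (hK : 0 < K) (hMK : 2 * M ≤ K)
    {x : E} (hsum : ∑ k ∈ Finset.range K, ‖(T ^ k) x‖ ^ 2 ≤ M * ‖x‖ ^ 2) :
    ‖(T ^ K) x‖ ^ 2 ≤ ‖x‖ ^ 2 / 2 := by
  refine le_of_mul_le_mul_left ?_ (Nat.cast_pos (α := ℝ).2 hK)
  calc K * ‖(T ^ K) x‖ ^ 2 = ∑ k ∈ Finset.range K, ‖(T ^ K) x‖ ^ 2 := by simp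
    _ ≤ ∑ k ∈ Finset.range K, ‖(T ^ k) x‖ ^ 2 := by
      gcongr with k hk
      exact antitone_norm_pow_apply hT x (Finset.mem_range.1 hk).le
    _ ≤ M * ‖x‖ ^ 2 := hsum
    _ ≤ K * (‖x‖ ^ 2 / 2) := by nlinarith [sq_nonneg ‖x‖]

variable [CompleteSpace E]

lemma bijective_one_sub_conj_smul (hT : ‖T‖ ≤ 1) {c : ℂ} (hc : ‖c‖ < 1) :
    Function.Bijective (1 - conj c • T : E →L[ℂ] E) := by
  refine ContinuousLinearMap.isUnit_iff_bijective.1 (isUnit_one_sub_of_norm_lt_one ?_)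
  rw [norm_smul, RCLike.norm_conj]
  exact (mul_le_of_le_one_right (norm_nonneg c) hT).trans_lt hc

lemma norm_le_one_of_mul_one_sub_eq {B : E →L[ℂ] E} (hT : ‖T‖ ≤ 1) {c : ℂ} (hc : ‖c‖ < 1)
    (hB : B * (1 - conj c • T) = T - c • 1) : ‖B‖ ≤ 1 := by
  refine B.opNorm_le_bound zero_le_one fun x => ?_
  obtain ⟨z, rfl⟩ := (bijective_one_sub_conj_smul hT hc).surjective x
  have hBz : B ((1 - conj c • T) z) = T z - c • z := by
    simpa using congrArg (fun A : E →L[ℂ] E => A z) hB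
  rw [hBz, one_mul]
  simpa using norm_apply_sub_smul_le hT hc.le z

lemma aeval_apply_eq_zero_of_sub_conj_smul (hT : ‖T‖ ≤ 1) {c : ℂ} (hc : ‖c‖ < 1) {P : ℂ[X]}
    {z : E} (h : aeval T P (z - conj c • T z) = 0) : aeval T P z = 0 := by
  have hcomm : Commute (aeval T P) (1 - conj c • T) := by
    have := (Commute.all P (1 - conj c • X)).map (aeval T)
    simpa only [map_sub, map_one, map_smul, aeval_X] using this
  refine (bijective_one_sub_conj_smul hT hc).injective ?_
  rw [map_zero, ← h]
  simpa using congrArg (fun A : E →L[ℂ] E => A z) hcomm.eq.symm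

/-- Blaschke factors are removed from the minimal polynomial one at a time: if `(X - c) P` kills
`x = z - c̄ T z`, then `P` kills `T z - c z`, the image of `x` under the Möbius transform. -/
lemma sum_norm_pow_apply_sq_le (hT : ‖T‖ ≤ 1) {r : ℝ} (hr : r < 1) (K : ℕ)
    (l : List ℂ) (hl : ∀ c ∈ l, ‖c‖ ≤ r) (x : E)
    (hx : aeval T (l.map fun c => X - C c).prod x = 0) :
    ∑ k ∈ Finset.range K, ‖(T ^ k) x‖ ^ 2 ≤ l.length * (2 / (1 - r)) * ‖x‖ ^ 2 := by
  induction l generalizing x with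
  | nil => simp [show x = 0 by simpa using hx]
  | cons c l ih =>
    have hr' : 0 < 1 - r := sub_pos.2 hr
    have hcr : ‖c‖ ≤ r := hl c List.mem_cons_self
    have hc : ‖c‖ < 1 := hcr.trans_lt hr
    obtain ⟨z, rfl⟩ := (bijective_one_sub_conj_smul hT hc).surjective x
    have hxz : (1 - conj c • T) z = z - conj c • T z := by simp
    rw [hxz] at hx ⊢
    set x := z - conj c • T z
    have hw : aeval T (l.map fun c => X - C c).prod (T z - c • z) = 0 := by
      rw [← aeval_apply_eq_zero_of_sub_conj_smul hT hc hx, List.map_cons, List.prod_cons, mul_comm,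
        map_mul, mul_apply_eq_comp]
      simp [Algebra.algebraMap_eq_smul_one]
    have hwx : ‖T z - c • z‖ ≤ ‖x‖ := norm_apply_sub_smul_le hT hc.le z
    have hzx : (1 - ‖c‖ ^ 2) * ‖z‖ ^ 2 ≤ 2 / (1 - r) * ‖x‖ ^ 2 := by
      have : 0 ≤ 1 - ‖c‖ := by linarith
      rw [div_mul_eq_mul_div, le_div_iff₀ hr']
      calc (1 - ‖c‖ ^ 2) * ‖z‖ ^ 2 * (1 - r) = (1 - ‖c‖) * ((1 + ‖c‖) * ‖z‖ ^ 2) * (1 - r) := by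
            ring
        _ ≤ (1 - ‖c‖) * ((1 + 1) * ‖z‖ ^ 2) * (1 - ‖c‖) := by gcongr
        _ = 2 * ((1 - ‖c‖) * ‖z‖) ^ 2 := by ring
        _ ≤ 2 * ‖x‖ ^ 2 := by gcongr; exact one_sub_norm_mul_norm_le hT c z
    calc _ ≤ _ := sum_norm_pow_apply_sq_le_add hc.le K z
      _ ≤ l.length * (2 / (1 - r)) * ‖x‖ ^ 2 + 2 / (1 - r) * ‖x‖ ^ 2 := by
        refine add_le_add ((ih (fun d hd => hl d (List.mem_cons_of_mem c hd)) _ hw).trans ?_) hzx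
        gcongr
      _ = _ := by push_cast [List.length_cons]; ring

end Operator

section Similarity

variable {E : Type*} [NormedAddCommGroup E] [InnerProductSpace ℂ E] [CompleteSpace E]

lemma norm_sq_sqrt_apply {G : E →L[ℂ] E} (hG : 0 ≤ G) (x : E) :
    ‖CFC.sqrt G x‖ ^ 2 = (⟪G x, x⟫_ℂ).re := by
  have hsa : IsSelfAdjoint (CFC.sqrt G) := (CFC.sqrt_nonneg G).isSelfAdjoint
  have hsq : G x = CFC.sqrt G (CFC.sqrt G x) := by
    nth_rewrite 1 [← CFC.sqrt_mul_sqrt_self G hG]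
    rfl
  rw [hsq, ← ContinuousLinearMap.adjoint_inner_right, hsa.adjoint_eq]
  exact (inner_self_eq_norm_sq (𝕜 := ℂ) _).symm

/-- The Gram operator of the form `x ↦ ‖x‖² + K⁻¹ ∑_{k < K} ‖Tᵏ x‖²`, which is an equivalent Hilbert
norm when `T` is a contraction. -/
def orbitGram (T : E →L[ℂ] E) (K : ℕ) : E →L[ℂ] E :=
  1 + (K : ℝ)⁻¹ • ∑ k ∈ Finset.range K, star (T ^ k) * T ^ k

lemma one_le_orbitGram (T : E →L[ℂ] E) (K : ℕ) : 1 ≤ orbitGram T K :=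
  le_add_of_nonneg_right <| smul_nonneg (by positivity) <|
    Finset.sum_nonneg fun k _ => star_mul_self_nonneg (T ^ k)

lemma re_inner_orbitGram (T : E →L[ℂ] E) (K : ℕ) (x : E) :
    (⟪orbitGram T K x, x⟫_ℂ).re =
      ‖x‖ ^ 2 + (K : ℝ)⁻¹ * ∑ k ∈ Finset.range K, ‖(T ^ k) x‖ ^ 2 := by
  have hterm (k : ℕ) : (⟪(star (T ^ k) * T ^ k) x, x⟫_ℂ).re = ‖(T ^ k) x‖ ^ 2 := by
    rw [mul_apply_eq_comp, ContinuousLinearMap.star_eq_adjoint,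
      ContinuousLinearMap.adjoint_inner_left]
    exact inner_self_eq_norm_sq (𝕜 := ℂ) _
  simp only [orbitGram, add_apply, one_apply_eq_self, smul_apply, sum_apply,
    inner_add_left, sum_inner, Complex.add_re, Complex.re_sum, hterm,
    inner_smul_left_eq_smul, Complex.smul_re, smul_eq_mul]
  exact congrArg (· + _) (inner_self_eq_norm_sq (𝕜 := ℂ) x)

variable {T : E →L[ℂ] E} {K : ℕ}

lemma re_inner_orbitGram_le (hT : ‖T‖ ≤ 1) (hK : 0 < K) (x : E) :
    (⟪orbitGram T K x, x⟫_ℂ).re ≤ 2 * ‖x‖ ^ 2 := by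
  have hKR : (0 : ℝ) < K := Nat.cast_pos.2 hK
  have hterm (k : ℕ) : ‖(T ^ k) x‖ ≤ ‖x‖ := by
    simpa using antitone_norm_pow_apply hT x k.zero_le
  calc (⟪orbitGram T K x, x⟫_ℂ).re
      ≤ ‖x‖ ^ 2 + (K : ℝ)⁻¹ * ∑ _k ∈ Finset.range K, ‖x‖ ^ 2 := by
        rw [re_inner_orbitGram]
        gcongr
        exact hterm _
    _ = 2 * ‖x‖ ^ 2 := by
        rw [Finset.sum_const, Finset.card_range, nsmul_eq_mul, inv_mul_cancel_left₀ hKR.ne',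
          two_mul]

lemma re_inner_orbitGram_map_le (hT : ‖T‖ ≤ 1) (hK : 0 < K)
    (hTK : ∀ x, ‖(T ^ K) x‖ ^ 2 ≤ ‖x‖ ^ 2 / 2) (x : E) :
    (⟪orbitGram T K (T x), T x⟫_ℂ).re ≤ (1 - 1 / (4 * K)) * (⟪orbitGram T K x, x⟫_ℂ).re := by
  have : (0 : ℝ) < K := Nat.cast_pos.2 hK
  have hshift : ∑ k ∈ Finset.range K, ‖(T ^ k) (T x)‖ ^ 2 =
      ∑ k ∈ Finset.range K, ‖(T ^ k) x‖ ^ 2 + ‖(T ^ K) x‖ ^ 2 - ‖x‖ ^ 2 := by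
    have hTk (k : ℕ) : (T ^ k) (T x) = (T ^ (k + 1)) x := by rw [pow_succ, mul_apply_eq_comp]
    simp only [hTk]
    rw [← Finset.sum_range_succ, Finset.sum_range_succ', pow_zero, one_apply_eq_self,
      add_sub_cancel_right]
  have hdecr : (⟪orbitGram T K (T x), T x⟫_ℂ).re ≤
      (⟪orbitGram T K x, x⟫_ℂ).re - (K : ℝ)⁻¹ * (‖x‖ ^ 2 / 2) := by
    have hTx : ‖T x‖ ^ 2 ≤ ‖x‖ ^ 2 := by gcongr; exact norm_apply_le_of_norm_le_one hT x
    have hlast : (K : ℝ)⁻¹ * ‖(T ^ K) x‖ ^ 2 ≤ (K : ℝ)⁻¹ * (‖x‖ ^ 2 / 2) := by gcongr; exact hTK x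
    rw [re_inner_orbitGram, re_inner_orbitGram, hshift]
    linarith
  have hupper : 1 / (4 * (K : ℝ)) * (⟪orbitGram T K x, x⟫_ℂ).re ≤ (K : ℝ)⁻¹ * (‖x‖ ^ 2 / 2) := by
    calc _ ≤ 1 / (4 * (K : ℝ)) * (2 * ‖x‖ ^ 2) := by gcongr; exact re_inner_orbitGram_le hT hK x
      _ = _ := by field_simp; norm_num
  linarith

/-- Rota's similarity: `A` is the square root of the Gram operator of the renormed space. -/
lemma exists_units_norm_conj_le (hT : ‖T‖ ≤ 1) (hK : 0 < K)
    (hTK : ∀ x, ‖(T ^ K) x‖ ^ 2 ≤ ‖x‖ ^ 2 / 2) :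
    ∃ A : (E →L[ℂ] E)ˣ, ‖(A : E →L[ℂ] E)‖ ≤ √2 ∧ ‖(↑A⁻¹ : E →L[ℂ] E)‖ ≤ 1 ∧
      ‖(A * T * ↑A⁻¹ : E →L[ℂ] E)‖ ≤ 1 - 1 / (8 * K) := by
  have hG0 : 0 ≤ orbitGram T K := zero_le_one.trans (one_le_orbitGram T K)
  obtain ⟨A, hA⟩ : IsUnit (CFC.sqrt (orbitGram T K)) :=
    (CFC.isUnit_sqrt_iff _ hG0).2 (CStarAlgebra.isUnit_of_le 1 (one_le_orbitGram T K))
  have hAsq (x : E) : ‖(A : E →L[ℂ] E) x‖ ^ 2 = (⟪orbitGram T K x, x⟫_ℂ).re := by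
    rw [hA, norm_sq_sqrt_apply hG0]
  have hAinv (y : E) : (A : E →L[ℂ] E) ((↑A⁻¹ : E →L[ℂ] E) y) = y := by
    rw [← mul_apply_eq_comp, A.mul_inv, one_apply_eq_self]
  have hK1 : (1 : ℝ) ≤ K := Nat.one_le_cast.2 hK
  have hc0 : 0 ≤ 1 - 1 / (8 * (K : ℝ)) :=
    sub_nonneg.2 <| (div_le_one (by positivity)).2 (by linarith)
  refine ⟨A, ContinuousLinearMap.opNorm_le_bound _ (Real.sqrt_nonneg 2) fun x => ?_,
    ContinuousLinearMap.opNorm_le_bound _ zero_le_one fun y => ?_,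
    ContinuousLinearMap.opNorm_le_bound _ hc0 fun y => ?_⟩
  · refine le_of_sq_le_sq ?_ (by positivity)
    rw [hAsq, mul_pow, Real.sq_sqrt zero_le_two]
    exact re_inner_orbitGram_le hT hK x
  · rw [one_mul]
    refine le_of_sq_le_sq ?_ (norm_nonneg y)
    nth_rewrite 2 [← hAinv y]
    rw [hAsq, re_inner_orbitGram]
    exact le_add_of_nonneg_right (by positivity)
  · refine le_of_sq_le_sq ?_ (mul_nonneg hc0 (norm_nonneg y))
    set x := (↑A⁻¹ : E →L[ℂ] E) y
    calc ‖(A : E →L[ℂ] E) (T x)‖ ^ 2 ≤ (1 - 1 / (4 * K)) * ‖(A : E →L[ℂ] E) x‖ ^ 2 := by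
          simpa only [hAsq] using re_inner_orbitGram_map_le hT hK hTK x
      _ ≤ (1 - 1 / (8 * K)) ^ 2 * ‖(A : E →L[ℂ] E) x‖ ^ 2 := by
          gcongr
          have : 1 / (4 * (K : ℝ)) = 2 * (1 / (8 * K)) := by field_simp; norm_num
          nlinarith [sq_nonneg (1 / (8 * (K : ℝ)))]
      _ = ((1 - 1 / (8 * K)) * ‖y‖) ^ 2 := by rw [hAinv, mul_pow]

end Similarity

section UnitCircle

variable {V : Type*} [NormedAddCommGroup V] [NormedSpace ℂ V]

lemma norm_circleAverage_le (f : ℂ → V) (c : ℂ) (R : ℝ) :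
    ‖Real.circleAverage f c R‖ ≤ Real.circleAverage (fun ζ => ‖f ζ‖) c R := by
  rw [Real.circleAverage_def, Real.circleAverage_def, norm_smul, smul_eq_mul,
    Real.norm_of_nonneg (by positivity)]
  gcongr
  exact intervalIntegral.norm_integral_le_integral_norm Real.two_pi_pos.le

lemma circleAverage_zpow (m : ℤ) :
    Real.circleAverage (fun ζ : ℂ => ζ ^ m) 0 1 = if m = 0 then 1 else 0 := by
  split_ifs with hm
  · simp only [hm, zpow_zero, Real.circleAverage_const]
  · have hint : (∮ ζ in C(0, 1), (ζ - 0)⁻¹ • ζ ^ m) = ∮ ζ in C(0, 1), (ζ - 0) ^ (m - 1) :=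
      circleIntegral.integral_congr zero_le_one fun ζ hζ => by
        have hζ0 : ζ ≠ 0 := ne_zero_of_mem_unit_sphere ⟨ζ, hζ⟩
        simp only [sub_zero, smul_eq_mul, zpow_sub_one₀ hζ0, mul_comm]
    rw [Real.circleAverage_eq_circleIntegral one_ne_zero, hint,
      circleIntegral.integral_sub_zpow_of_ne (by lia), smul_zero]

variable [CompleteSpace V]

lemma circleAverage_zpow_smul (m : ℤ) (B : V) :
    Real.circleAverage (fun ζ : ℂ => ζ ^ m • B) 0 1 = if m = 0 then B else 0 := by
  have h := circleAverage_zpow m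
  rw [Real.circleAverage_def] at h ⊢
  rw [intervalIntegral.integral_smul_const, ← smul_assoc, h, ite_smul, one_smul, zero_smul]

lemma circleAverage_tsum {F : ℕ → ℂ → V} {b : ℕ → ℝ}
    (hF : ∀ k, ContinuousOn (F k) (Metric.sphere 0 1)) (hb : Summable b)
    (hFb : ∀ k, ∀ ζ ∈ Metric.sphere (0 : ℂ) 1, ‖F k ζ‖ ≤ b k) :
    Real.circleAverage (fun ζ => ∑' k, F k ζ) 0 1 = ∑' k, Real.circleAverage (F k) 0 1 := by
  have hmem (θ : ℝ) : circleMap 0 1 θ ∈ Metric.sphere (0 : ℂ) 1 :=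
    circleMap_mem_sphere 0 zero_le_one θ
  have hcont (k : ℕ) : Continuous fun θ : ℝ => F k (circleMap 0 1 θ) :=
    (hF k).comp_continuous (continuous_circleMap 0 1) hmem
  simp only [Real.circleAverage_def]
  rw [tsum_const_smul'' (2 * Real.pi)⁻¹]
  congr 1
  exact (intervalIntegral.hasSum_integral_of_dominated_convergence (fun k _ => b k)
    (fun k => (hcont k).aestronglyMeasurable) (fun k => .of_forall fun θ _ => hFb k _ (hmem θ))
    (.of_forall fun _ _ => hb) intervalIntegrable_const
    (.of_forall fun θ _ => (hb.of_norm_bounded fun k => hFb k _ (hmem θ)).hasSum)).tsum_eq.symm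

lemma circleAverage_tsum_smul {a : ℕ → ℂ} (ha : Summable fun k => ‖a k‖) {P : ℂ → V}
    (hP : ContinuousOn P (Metric.sphere 0 1)) :
    Real.circleAverage (fun ζ => (∑' k, a k * ζ ^ k) • P ζ) 0 1 =
      ∑' k, a k • Real.circleAverage (fun ζ => ζ ^ k • P ζ) 0 1 := by
  obtain ⟨C, hC⟩ := (isCompact_sphere (0 : ℂ) 1).exists_bound_of_continuousOn hP
  have hnorm (k : ℕ) {ζ : ℂ} (hζ : ζ ∈ Metric.sphere (0 : ℂ) 1) : ‖a k * ζ ^ k‖ = ‖a k‖ := by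
    rw [norm_mul, norm_pow, mem_sphere_zero_iff_norm.1 hζ, one_pow, mul_one]
  calc _ = Real.circleAverage (fun ζ => ∑' k, (a k * ζ ^ k) • P ζ) 0 1 := by
        refine Real.circleAverage_congr_sphere fun ζ hζ => ?_
        rw [abs_one] at hζ
        exact ((ha.of_norm_bounded fun k => (hnorm k hζ).le).tsum_smul_const (P ζ)).symm
    _ = ∑' k, Real.circleAverage (fun ζ => (a k * ζ ^ k) • P ζ) 0 1 := by
        refine circleAverage_tsum (fun k => ContinuousOn.fun_smul (by fun_prop) hP)
          (ha.mul_right C) fun k ζ hζ => ?_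
        rw [norm_smul, hnorm k hζ]
        gcongr
        exact hC ζ hζ
    _ = ∑' k, a k • Real.circleAverage (fun ζ => ζ ^ k • P ζ) 0 1 := by
        simp only [mul_smul, Real.circleAverage_fun_smul]

end UnitCircle

section Poisson

variable {E : Type*} [NormedAddCommGroup E] [InnerProductSpace ℂ E] [CompleteSpace E]

/-- The Poisson kernel `(1 - S)⁻¹ + (1 - S*)⁻¹ - 1` of a strict contraction; its value at `ζ⁻¹ • S`
is the density at `ζ` of the operator-valued harmonic measure of `S` on the unit circle. -/
def opPoissonKernel (S : E →L[ℂ] E) : E →L[ℂ] E :=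
  Ring.inverse (1 - S) + star (Ring.inverse (1 - S)) - 1

variable {S : E →L[ℂ] E}

lemma mul_inverse_one_sub (hS : ‖S‖ < 1) :
    S * Ring.inverse (1 - S) = Ring.inverse (1 - S) - 1 := by
  have h := Ring.mul_inverse_cancel _ (isUnit_one_sub_of_norm_lt_one hS)
  rw [sub_mul, one_mul] at h
  exact eq_sub_of_add_eq' (sub_eq_iff_eq_add.1 h).symm

lemma opPoissonKernel_nonneg (hS : ‖S‖ < 1) : 0 ≤ opPoissonKernel S := by
  set R := Ring.inverse (1 - S)
  have hSR : S * R = R - 1 := mul_inverse_one_sub hS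
  have hfactor : opPoissonKernel S = star R * (1 - star S * S) * R := by
    calc opPoissonKernel S = R + star R - 1 := rfl
      _ = star R * R - star (S * R) * (S * R) := by
        rw [hSR, star_sub, star_one]
        noncomm_ring
      _ = star R * (1 - star S * S) * R := by
        rw [star_mul]
        noncomm_ring
  rw [hfactor]
  refine star_left_conjugate_nonneg (sub_nonneg.2 ?_) R
  rw [← CStarAlgebra.norm_le_one_iff_of_nonneg _ (star_mul_self_nonneg S),
    CStarRing.norm_star_mul_self]
  exact mul_le_one₀ hS.le (norm_nonneg S) hS.le

lemma norm_opPoissonKernel_le (hS : ‖S‖ < 1) : ‖opPoissonKernel S‖ ≤ 2 / (1 - ‖S‖) := by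
  set R := Ring.inverse (1 - S) with hR
  have hRnorm : ‖R‖ ≤ (1 - ‖S‖)⁻¹ := by
    rw [hR, ← geom_series_eq_inverse S hS]
    have h1 : ‖(1 : E →L[ℂ] E)‖ ≤ 1 := ContinuousLinearMap.norm_id_le
    linarith [tsum_geometric_le_of_norm_lt_one S hS]
  have hP : opPoissonKernel S = S * R + star R := by
    rw [mul_inverse_one_sub hS, opPoissonKernel]
    abel
  calc ‖opPoissonKernel S‖ ≤ ‖S‖ * ‖R‖ + ‖R‖ := by
        rw [hP]
        exact (norm_add_le _ _).trans (add_le_add (norm_mul_le S R) (norm_star R).le)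
    _ ≤ 1 * (1 - ‖S‖)⁻¹ + (1 - ‖S‖)⁻¹ := by gcongr
    _ = 2 / (1 - ‖S‖) := by ring

lemma norm_inv_smul_of_mem_sphere {ζ : ℂ} (hζ : ζ ∈ Metric.sphere (0 : ℂ) 1) :
    ‖ζ⁻¹ • S‖ = ‖S‖ := by
  rw [norm_smul, norm_inv, mem_sphere_zero_iff_norm.1 hζ, inv_one, one_mul]

lemma continuousOn_opPoissonKernel (hS : ‖S‖ < 1) :
    ContinuousOn (fun ζ : ℂ => opPoissonKernel (ζ⁻¹ • S)) (Metric.sphere 0 1) := by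
  have hR : ContinuousOn (fun ζ : ℂ => Ring.inverse (1 - ζ⁻¹ • S)) (Metric.sphere 0 1) := by
    intro ζ hζ
    have hζ0 : ζ ≠ 0 := ne_zero_of_mem_unit_sphere ⟨ζ, hζ⟩
    obtain ⟨u, hu⟩ := isUnit_one_sub_of_norm_lt_one ((norm_inv_smul_of_mem_sphere hζ).trans_lt hS)
    have hinv : ContinuousAt Ring.inverse (1 - ζ⁻¹ • S) := hu ▸ NormedRing.inverse_continuousAt u
    exact (hinv.comp (f := fun ζ : ℂ => 1 - ζ⁻¹ • S)
      (by fun_prop (disch := exact hζ0))).continuousWithinAt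
  exact (hR.add hR.star).sub continuousOn_const

lemma hasSum_zpow_smul_opPoissonKernel (hS : ‖S‖ < 1) (j : ℤ) {ζ : ℂ}
    (hζ : ζ ∈ Metric.sphere (0 : ℂ) 1) :
    HasSum (fun k : ℕ => ζ ^ (j - k) • S ^ k + ζ ^ (j + (k + 1 : ℕ)) • star S ^ (k + 1))
      (ζ ^ j • opPoissonKernel (ζ⁻¹ • S)) := by
  have hζ0 : ζ ≠ 0 := ne_zero_of_mem_unit_sphere ⟨ζ, hζ⟩
  have hstar : star (ζ⁻¹ • S) = ζ • star S := by
    rw [star_smul, RCLike.star_def, map_inv₀, ← Complex.inv_eq_conj (mem_sphere_zero_iff_norm.1 hζ),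
      inv_inv]
  have hR := hasSum_geom_series_inverse _ ((norm_inv_smul_of_mem_sphere hζ).trans_lt hS)
  have hRstar := (hasSum_nat_add_iff' 1).2 hR.star
  simp only [star_pow, hstar, Finset.sum_range_one, pow_zero] at hRstar
  have h := (hR.add hRstar).const_smul (ζ ^ j)
  rw [← add_sub_assoc] at h
  refine h.congr_fun fun k => ?_
  rw [smul_add, _root_.smul_pow, _root_.smul_pow, smul_smul, smul_smul, zpow_sub₀ hζ0,
    zpow_add₀ hζ0, inv_pow, div_eq_mul_inv, zpow_natCast, zpow_natCast]

lemma circleAverage_zpow_smul_opPoissonKernel (hS : ‖S‖ < 1) (j : ℕ) :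
    Real.circleAverage (fun ζ : ℂ => ζ ^ (j : ℤ) • opPoissonKernel (ζ⁻¹ • S)) 0 1 = S ^ j := by
  have hzpow (m : ℤ) (B : E →L[ℂ] E) :
      ContinuousOn (fun ζ : ℂ => ζ ^ m • B) (Metric.sphere 0 1) := fun ζ hζ =>
    ((continuousAt_zpow₀ ζ m (.inl (ne_zero_of_mem_unit_sphere ⟨ζ, hζ⟩))).smul
      continuousAt_const).continuousWithinAt
  have hnorm (m : ℤ) (B : E →L[ℂ] E) {ζ : ℂ} (hζ : ζ ∈ Metric.sphere (0 : ℂ) 1) :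
      ‖ζ ^ m • B‖ = ‖B‖ := by
    rw [norm_smul, norm_zpow, mem_sphere_zero_iff_norm.1 hζ, one_zpow, one_mul]
  have hsum : Summable fun k : ℕ => ‖S ^ k‖ := summable_norm_geometric_of_norm_lt_one hS
  have hstar (k : ℕ) : ‖star S ^ k‖ = ‖S ^ k‖ := by rw [← star_pow, norm_star]
  have hle (k : ℕ) {ζ : ℂ} (hζ : ζ ∈ Metric.sphere (0 : ℂ) 1) :
      ‖ζ ^ (j - k : ℤ) • S ^ k + ζ ^ (j + (k + 1 : ℕ) : ℤ) • star S ^ (k + 1)‖ ≤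
        ‖S ^ k‖ + ‖S ^ (k + 1)‖ :=
    (norm_add_le _ _).trans_eq (by rw [hnorm _ _ hζ, hnorm _ _ hζ, hstar])
  calc _ = Real.circleAverage (fun ζ : ℂ => ∑' k : ℕ,
        (ζ ^ (j - k : ℤ) • S ^ k + ζ ^ (j + (k + 1 : ℕ) : ℤ) • star S ^ (k + 1))) 0 1 := by
        refine Real.circleAverage_congr_sphere fun ζ hζ => ?_
        rw [abs_one] at hζ
        exact (hasSum_zpow_smul_opPoissonKernel hS j hζ).tsum_eq.symm
    _ = ∑' k : ℕ, if (j - k : ℤ) = 0 then S ^ k else 0 := by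
        rw [circleAverage_tsum (fun k => (hzpow _ _).fun_add (hzpow _ _))
          (hsum.add ((summable_nat_add_iff 1).2 hsum)) fun k ζ hζ => hle k hζ]
        refine tsum_congr fun k => ?_
        rw [Real.circleAverage_fun_add ((hzpow _ _).circleIntegrable zero_le_one)
          ((hzpow _ _).circleIntegrable zero_le_one), circleAverage_zpow_smul,
          circleAverage_zpow_smul, if_neg (by lia : (j + (k + 1 : ℕ) : ℤ) ≠ 0), add_zero]
    _ = S ^ j := by
        rw [tsum_eq_single j fun k hk => if_neg (by lia), if_pos (sub_self _)]

lemma circleAverage_tsum_smul_opPoissonKernel (hS : ‖S‖ < 1) {a : ℕ → ℂ}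
    (ha : Summable fun k => ‖a k‖) :
    Real.circleAverage (fun ζ : ℂ => (∑' k, a k * ζ ^ k) • opPoissonKernel (ζ⁻¹ • S)) 0 1 =
      ∑' k, a k • S ^ k := by
  rw [circleAverage_tsum_smul ha (continuousOn_opPoissonKernel hS)]
  simp only [← circleAverage_zpow_smul_opPoissonKernel hS, zpow_natCast]

end Poisson

section VonNeumann

lemma rpow_add_mul_sub_le {p m s : ℝ} (hp : 1 ≤ p) (hm : 0 < m) (hs : 0 ≤ s) :
    m ^ p + p * m ^ (p - 1) * (s - m) ≤ s ^ p := by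
  have hbernoulli := one_add_mul_self_le_rpow_one_add
    (show -1 ≤ s / m - 1 by linarith [div_nonneg hs hm.le]) hp
  rw [add_sub_cancel, Real.div_rpow hs hm.le, le_div_iff₀ (Real.rpow_pos_of_pos hm p)] at hbernoulli
  refine le_of_eq_of_le ?_ hbernoulli
  rw [Real.rpow_sub_one hm.ne']
  field_simp

lemma circleAverage_mul_rpow_le {p : ℝ} (hp : 1 ≤ p) {s w : ℂ → ℝ}
    (hs : ContinuousOn s (Metric.sphere 0 1)) (hw : ContinuousOn w (Metric.sphere 0 1))
    (hs0 : ∀ ζ, 0 ≤ s ζ) (hw0 : ∀ ζ ∈ Metric.sphere (0 : ℂ) 1, 0 ≤ w ζ)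
    (hw1 : Real.circleAverage w 0 1 = 1) :
    Real.circleAverage (fun ζ => s ζ * w ζ) 0 1 ^ p ≤
      Real.circleAverage (fun ζ => s ζ ^ p * w ζ) 0 1 := by
  set m := Real.circleAverage (fun ζ => s ζ * w ζ) 0 1
  have hint {f : ℂ → ℝ} (hf : ContinuousOn f (Metric.sphere 0 1)) : CircleIntegrable f 0 1 :=
    hf.circleIntegrable zero_le_one
  rcases le_or_gt m 0 with hm | hm
  · have hm0 : 0 ≤ m := Real.circleAverage_nonneg_of_nonneg fun ζ hζ =>
      mul_nonneg (hs0 ζ) (hw0 ζ (by rwa [abs_one] at hζ))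
    rw [hm.antisymm hm0, Real.zero_rpow (by positivity)]
    exact Real.circleAverage_nonneg_of_nonneg fun ζ hζ =>
      mul_nonneg (Real.rpow_nonneg (hs0 ζ) p) (hw0 ζ (by rwa [abs_one] at hζ))
  · set c := p * m ^ (p - 1)
    have hcw : ContinuousOn (fun ζ => (m ^ p - c * m) • w ζ) (Metric.sphere 0 1) :=
      hw.fun_const_smul _
    have hcsw : ContinuousOn (fun ζ => c • (s ζ * w ζ)) (Metric.sphere 0 1) :=
      (hs.fun_mul hw).fun_const_smul _
    have hspw : ContinuousOn (fun ζ => s ζ ^ p * w ζ) (Metric.sphere 0 1) :=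
      (hs.rpow_const fun _ _ => .inr (zero_le_one.trans hp)).fun_mul hw
    calc m ^ p = Real.circleAverage (fun ζ => (m ^ p - c * m) • w ζ + c • (s ζ * w ζ)) 0 1 := by
          rw [Real.circleAverage_fun_add (hint hcw) (hint hcsw), Real.circleAverage_fun_smul,
            Real.circleAverage_fun_smul, hw1, smul_eq_mul, smul_eq_mul]
          ring
      _ ≤ Real.circleAverage (fun ζ => s ζ ^ p * w ζ) 0 1 := by
          refine Real.circleAverage_mono (hint (hcw.fun_add hcsw)) (hint hspw) fun ζ hζ => ?_
          rw [abs_one] at hζ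
          calc _ = (m ^ p + c * (s ζ - m)) * w ζ := by simp only [smul_eq_mul]; ring
            _ ≤ _ := mul_le_mul_of_nonneg_right (rpow_add_mul_sub_le hp hm (hs0 ζ)) (hw0 ζ hζ)

variable {E : Type*} [NormedAddCommGroup E] [InnerProductSpace ℂ E] [CompleteSpace E]

lemma norm_inner_le_of_nonneg {P : E →L[ℂ] E} (hP : 0 ≤ P) (x y : E) :
    ‖⟪y, P x⟫_ℂ‖ ≤ ((⟪x, P x⟫_ℂ).re + (⟪y, P y⟫_ℂ).re) / 2 := by
  obtain ⟨D, rfl⟩ := CStarAlgebra.nonneg_iff_eq_star_mul_self.1 hP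
  have hD (u v : E) : ⟪u, (star D * D) v⟫_ℂ = ⟪D u, D v⟫_ℂ := D.adjoint_inner_right u (D v)
  have hsq (u : E) : (⟪D u, D u⟫_ℂ).re = ‖D u‖ ^ 2 := inner_self_eq_norm_sq (𝕜 := ℂ) (D u)
  rw [hD, hD, hD, hsq, hsq]
  linarith [norm_inner_le_norm (𝕜 := ℂ) (D y) (D x), two_mul_le_add_sq ‖D x‖ ‖D y‖]

lemma inner_circleAverage_apply {F : ℂ → E →L[ℂ] E} {c : ℂ} {R : ℝ}
    (hF : CircleIntegrable F c R) (x y : E) :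
    ⟪y, Real.circleAverage F c R x⟫_ℂ = Real.circleAverage (fun ζ => ⟪y, F ζ x⟫_ℂ) c R :=
  (((innerSL ℂ y ∘L ContinuousLinearMap.apply ℂ E x).restrictScalars ℝ).circleAverage_comp_comm
    hF).symm

variable {S : E →L[ℂ] E}

lemma continuousOn_inner_opPoissonKernel (hS : ‖S‖ < 1) (x y : E) :
    ContinuousOn (fun ζ : ℂ => ⟪y, opPoissonKernel (ζ⁻¹ • S) x⟫_ℂ) (Metric.sphere 0 1) :=
  continuousOn_const.inner ((continuousOn_opPoissonKernel hS).clm_apply continuousOn_const)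

lemma re_inner_opPoissonKernel_nonneg (hS : ‖S‖ < 1) (x : E) :
    0 ≤ (⟪x, opPoissonKernel S x⟫_ℂ).re :=
  ((ContinuousLinearMap.nonneg_iff_isPositive _).1
    (opPoissonKernel_nonneg hS)).re_inner_nonneg_right x

lemma re_inner_opPoissonKernel_le (hS : ‖S‖ < 1) {x : E} (hx : ‖x‖ = 1) :
    (⟪x, opPoissonKernel S x⟫_ℂ).re ≤ 2 / (1 - ‖S‖) :=
  calc (⟪x, opPoissonKernel S x⟫_ℂ).re ≤ ‖x‖ * ‖opPoissonKernel S x‖ :=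
      re_inner_le_norm (𝕜 := ℂ) x _
    _ ≤ ‖opPoissonKernel S‖ := by
      simpa only [hx, one_mul, mul_one] using (opPoissonKernel S).le_opNorm x
    _ ≤ 2 / (1 - ‖S‖) := norm_opPoissonKernel_le hS

lemma circleAverage_re_inner_opPoissonKernel (hS : ‖S‖ < 1) (x : E) :
    Real.circleAverage (fun ζ : ℂ => (⟪x, opPoissonKernel (ζ⁻¹ • S) x⟫_ℂ).re) 0 1 = ‖x‖ ^ 2 := by
  have hone : Real.circleAverage (fun ζ : ℂ => opPoissonKernel (ζ⁻¹ • S)) 0 1 = 1 := by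
    simpa using circleAverage_zpow_smul_opPoissonKernel hS 0
  have hinner := inner_circleAverage_apply
    ((continuousOn_opPoissonKernel hS).circleIntegrable zero_le_one) x x
  rw [hone] at hinner
  calc _ = (Real.circleAverage (fun ζ : ℂ => ⟪x, opPoissonKernel (ζ⁻¹ • S) x⟫_ℂ) 0 1).re :=
        Complex.reCLM.circleAverage_comp_comm
          ((continuousOn_inner_opPoissonKernel hS x x).circleIntegrable zero_le_one)
    _ = ‖x‖ ^ 2 := by
        rw [← hinner]
        exact inner_self_eq_norm_sq (𝕜 := ℂ) x

/-- The density on the unit circle of the mean of the harmonic measures of `S` at the vectors `x`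
and `y`. -/
def harmonicDensity (S : E →L[ℂ] E) (x y : E) (ζ : ℂ) : ℝ :=
  (2 : ℝ)⁻¹ • ((⟪x, opPoissonKernel (ζ⁻¹ • S) x⟫_ℂ).re + (⟪y, opPoissonKernel (ζ⁻¹ • S) y⟫_ℂ).re)

lemma continuousOn_re_inner_opPoissonKernel (hS : ‖S‖ < 1) (x : E) :
    ContinuousOn (fun ζ : ℂ => (⟪x, opPoissonKernel (ζ⁻¹ • S) x⟫_ℂ).re) (Metric.sphere 0 1) :=
  Complex.continuous_re.comp_continuousOn (continuousOn_inner_opPoissonKernel hS x x)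

lemma continuousOn_harmonicDensity (hS : ‖S‖ < 1) (x y : E) :
    ContinuousOn (harmonicDensity S x y) (Metric.sphere 0 1) :=
  ((continuousOn_re_inner_opPoissonKernel hS x).fun_add
    (continuousOn_re_inner_opPoissonKernel hS y)).fun_const_smul _

variable {x y : E} {ζ : ℂ}

lemma circleAverage_harmonicDensity (hS : ‖S‖ < 1) (hx : ‖x‖ = 1) (hy : ‖y‖ = 1) :
    Real.circleAverage (harmonicDensity S x y) 0 1 = 1 := by
  have hint (z : E) :=
    (continuousOn_re_inner_opPoissonKernel hS z).circleIntegrable zero_le_one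
  unfold harmonicDensity
  rw [Real.circleAverage_fun_smul, Real.circleAverage_fun_add (hint x) (hint y),
    circleAverage_re_inner_opPoissonKernel hS, circleAverage_re_inner_opPoissonKernel hS, hx, hy]
  norm_num

lemma harmonicDensity_nonneg (hS : ‖S‖ < 1) (hζ : ζ ∈ Metric.sphere (0 : ℂ) 1) :
    0 ≤ harmonicDensity S x y ζ := by
  have hSζ : ‖ζ⁻¹ • S‖ < 1 := (norm_inv_smul_of_mem_sphere hζ).trans_lt hS
  exact smul_nonneg (by norm_num) (add_nonneg (re_inner_opPoissonKernel_nonneg hSζ x)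
    (re_inner_opPoissonKernel_nonneg hSζ y))

lemma harmonicDensity_le (hS : ‖S‖ < 1) (hx : ‖x‖ = 1) (hy : ‖y‖ = 1)
    (hζ : ζ ∈ Metric.sphere (0 : ℂ) 1) : harmonicDensity S x y ζ ≤ 2 / (1 - ‖S‖) := by
  have hnorm := norm_inv_smul_of_mem_sphere (S := S) hζ
  have hxle := re_inner_opPoissonKernel_le (hnorm.trans_lt hS) hx
  have hyle := re_inner_opPoissonKernel_le (hnorm.trans_lt hS) hy
  rw [hnorm] at hxle hyle
  rw [harmonicDensity, smul_eq_mul]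
  linarith

lemma norm_inner_opPoissonKernel_le_harmonicDensity (hS : ‖S‖ < 1)
    (hζ : ζ ∈ Metric.sphere (0 : ℂ) 1) :
    ‖⟪y, opPoissonKernel (ζ⁻¹ • S) x⟫_ℂ‖ ≤ harmonicDensity S x y ζ := by
  rw [harmonicDensity, smul_eq_mul, inv_mul_eq_div]
  exact norm_inner_le_of_nonneg
    (opPoissonKernel_nonneg ((norm_inv_smul_of_mem_sphere hζ).trans_lt hS)) x y

variable {a : ℕ → ℂ}

lemma continuousOn_tsum_mul_pow (ha : Summable fun k => ‖a k‖) :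
    ContinuousOn (fun ζ : ℂ => ∑' k, a k * ζ ^ k) (Metric.sphere 0 1) :=
  continuousOn_tsum (fun k => by fun_prop) ha fun k ζ hζ => by
    rw [norm_mul, norm_pow, mem_sphere_zero_iff_norm.1 hζ, one_pow, mul_one]

lemma norm_inner_tsum_smul_pow_le (hS : ‖S‖ < 1) (ha : Summable fun k => ‖a k‖) (x y : E) :
    ‖⟪y, (∑' k, a k • S ^ k) x⟫_ℂ‖ ≤
      Real.circleAverage (fun ζ => ‖∑' k, a k * ζ ^ k‖ * harmonicDensity S x y ζ) 0 1 := by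
  have hF := continuousOn_tsum_mul_pow ha
  have hP := continuousOn_opPoissonKernel hS
  rw [← circleAverage_tsum_smul_opPoissonKernel hS ha,
    inner_circleAverage_apply ((hF.fun_smul hP).circleIntegrable zero_le_one)]
  simp only [smul_apply, inner_smul_right]
  refine (norm_circleAverage_le _ _ _).trans (Real.circleAverage_mono
    ((hF.fun_mul (continuousOn_inner_opPoissonKernel hS x y)).norm.circleIntegrable zero_le_one)
    ((hF.norm.fun_mul (continuousOn_harmonicDensity hS x y)).circleIntegrable zero_le_one)
    fun ζ hζ => ?_)
  rw [abs_one] at hζ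
  rw [norm_mul]
  gcongr
  exact norm_inner_opPoissonKernel_le_harmonicDensity hS hζ

lemma norm_inner_tsum_smul_pow_rpow_le (hS : ‖S‖ < 1) (ha : Summable fun k => ‖a k‖)
    {p : ℝ} (hp : 1 ≤ p) (hx : ‖x‖ = 1) (hy : ‖y‖ = 1) :
    ‖⟪y, (∑' k, a k • S ^ k) x⟫_ℂ‖ ^ p ≤
      2 / (1 - ‖S‖) * Real.circleAverage (fun ζ => ‖∑' k, a k * ζ ^ k‖ ^ p) 0 1 := by
  have hF := (continuousOn_tsum_mul_pow ha).norm
  have hFp := hF.rpow_const (p := p) fun _ _ => .inr (zero_le_one.trans hp)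
  have hw := continuousOn_harmonicDensity hS x y
  calc _ ≤
        Real.circleAverage (fun ζ => ‖∑' k, a k * ζ ^ k‖ * harmonicDensity S x y ζ) 0 1 ^ p := by
        gcongr
        exact norm_inner_tsum_smul_pow_le hS ha x y
    _ ≤ Real.circleAverage (fun ζ => ‖∑' k, a k * ζ ^ k‖ ^ p * harmonicDensity S x y ζ) 0 1 :=
        circleAverage_mul_rpow_le hp hF hw (fun ζ => norm_nonneg _)
          (fun ζ => harmonicDensity_nonneg hS) (circleAverage_harmonicDensity hS hx hy)
    _ ≤ Real.circleAverage (fun ζ => (2 / (1 - ‖S‖)) • ‖∑' k, a k * ζ ^ k‖ ^ p) 0 1 := by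
        refine Real.circleAverage_mono ((hFp.fun_mul hw).circleIntegrable zero_le_one)
          ((hFp.fun_const_smul _).circleIntegrable zero_le_one) fun ζ hζ => ?_
        rw [abs_one] at hζ
        rw [smul_eq_mul, mul_comm (2 / _)]
        gcongr
        exact harmonicDensity_le hS hx hy hζ
    _ = _ := Real.circleAverage_fun_smul

lemma norm_tsum_smul_pow_rpow_le (hS : ‖S‖ < 1) (ha : Summable fun k => ‖a k‖)
    {p : ℝ} (hp : 1 ≤ p) :
    ‖∑' k, a k • S ^ k‖ ^ p ≤
      2 / (1 - ‖S‖) * Real.circleAverage (fun ζ => ‖∑' k, a k * ζ ^ k‖ ^ p) 0 1 := by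
  have hp0 : 0 < p := zero_lt_one.trans_le hp
  set M := 2 / (1 - ‖S‖) * Real.circleAverage (fun ζ => ‖∑' k, a k * ζ ^ k‖ ^ p) 0 1
  have hM : 0 ≤ M := mul_nonneg (div_nonneg zero_le_two (sub_nonneg.2 hS.le))
    (Real.circleAverage_nonneg_of_nonneg fun ζ _ => by positivity)
  rw [← Real.le_rpow_inv_iff_of_pos (norm_nonneg _) hM hp0]
  refine ContinuousLinearMap.opNorm_le_of_re_inner_le (by positivity) fun x y hx hy => ?_
  rw [← inner_conj_symm, RCLike.conj_re]
  refine (RCLike.re_le_norm _).trans ?_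
  rw [Real.le_rpow_inv_iff_of_pos (norm_nonneg _) hM hp0]
  exact norm_inner_tsum_smul_pow_rpow_le hS ha hp hx hy

end VonNeumann

section SpectralRadiusBound

/-- The `k`-th Taylor coefficient of `f` at the origin. -/
def taylorCoeff (f : ℂ → ℂ) (k : ℕ) : ℂ :=
  iteratedDeriv k f 0 / (k.factorial : ℂ)

variable {f : ℂ → ℂ}

lemma hasSum_taylorCoeff_mul_pow (hf : DifferentiableOn ℂ f (Metric.ball 0 1)) {z : ℂ}
    (hz : z ∈ Metric.ball (0 : ℂ) 1) : HasSum (fun k => taylorCoeff f k * z ^ k) (f z) := by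
  refine (Complex.hasSum_taylorSeries_on_ball hf hz).congr_fun fun k => ?_
  rw [sub_zero, smul_eq_mul, smul_eq_mul, taylorCoeff]
  ring

variable {E : Type*} [NormedAddCommGroup E] [InnerProductSpace ℂ E] [CompleteSpace E]
  {T : E →L[ℂ] E}

lemma norm_tsum_taylorCoeff_smul_pow_rpow_le (hf : DifferentiableOn ℂ f (Metric.ball 0 1))
    {ρ : ℝ} (hρ0 : 0 < ρ) (hρ : ρ < 1) {δ : ℝ} (hδ : 0 < δ) (hT : ‖T‖ ≤ (1 - δ) * ρ)
    {p : ℝ} (hp : 1 ≤ p) :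
    ‖∑' k, taylorCoeff f k • T ^ k‖ ^ p ≤
      2 / δ * Real.circleAverage (fun z => ‖f z‖ ^ p) 0 ρ := by
  set S : E →L[ℂ] E := (ρ⁻¹ : ℂ) • T with hSdef
  have hρz {ζ : ℂ} (hζ : ‖ζ‖ = 1) : ρ * ζ ∈ Metric.ball (0 : ℂ) 1 := by
    rwa [mem_ball_zero_iff, norm_mul, hζ, mul_one, Complex.norm_of_nonneg hρ0.le]
  have hS : ‖S‖ ≤ 1 - δ := by
    rwa [hSdef, norm_smul, norm_inv, Complex.norm_of_nonneg hρ0.le, inv_mul_le_iff₀ hρ0, mul_comm]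
  have hsummable : Summable fun k => ‖taylorCoeff f k * ρ ^ k‖ := by
    simpa only [mul_one] using (hasSum_taylorCoeff_mul_pow hf (hρz norm_one)).summable.norm
  have hcoeff (k : ℕ) : taylorCoeff f k • T ^ k = (taylorCoeff f k * ρ ^ k) • S ^ k := by
    rw [hSdef, _root_.smul_pow, smul_smul, mul_assoc, ← mul_pow,
      mul_inv_cancel₀ (Complex.ofReal_ne_zero.2 hρ0.ne'), one_pow, mul_one]
  simp only [hcoeff]
  calc _ ≤ _ := norm_tsum_smul_pow_rpow_le (by linarith) hsummable hp
    _ = 2 / (1 - ‖S‖) * Real.circleAverage (fun z => ‖f z‖ ^ p) 0 ρ := by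
      rw [Real.circleAverage_eq_circleAverage_zero_one (c := 0) (R := ρ)]
      congr 1
      refine Real.circleAverage_congr_sphere fun ζ hζ => ?_
      rw [abs_one, mem_sphere_zero_iff_norm] at hζ
      have h := (hasSum_taylorCoeff_mul_pow hf (hρz hζ)).tsum_eq
      simp only [mul_pow, ← mul_assoc] at h
      simp only [h, add_zero]
    _ ≤ _ := by
      gcongr
      · exact Real.circleAverage_nonneg_of_nonneg fun _ _ => by positivity
      · linarith

lemma norm_tsum_smul_pow_le_conj (A : (E →L[ℂ] E)ˣ) (T : E →L[ℂ] E) (a : ℕ → ℂ) :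
    ‖∑' k, a k • T ^ k‖ ≤ ‖(↑A⁻¹ : E →L[ℂ] E)‖ *
      ‖∑' k, a k • (A * T * ↑A⁻¹ : E →L[ℂ] E) ^ k‖ * ‖(A : E →L[ℂ] E)‖ := by
  set B := ∑' k, a k • T ^ k
  have hconj : A * B * ↑A⁻¹ = ∑' k, a k • (A * T * ↑A⁻¹ : E →L[ℂ] E) ^ k := by
    set φ := (ContinuousLinearEquiv.unitsEquiv ℂ E A).conjContinuousAlgEquiv
    have h : φ B = ∑' k, φ (a k • T ^ k) := φ.toContinuousLinearEquiv.map_tsum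
    simp only [map_smul, map_pow] at h
    exact h
  calc ‖B‖ = ‖(↑A⁻¹ * (A * B * ↑A⁻¹) * A : E →L[ℂ] E)‖ := by
        simp only [mul_assoc, Units.inv_mul, mul_one, Units.inv_mul_cancel_left]
    _ ≤ _ := by
        rw [hconj]
        exact norm_mul_le_of_le (norm_mul_le _ _) le_rfl

theorem norm_tsum_taylorCoeff_smul_pow_rpow_le_of_pow (hT : ‖T‖ ≤ 1) {K : ℕ} (hK : 0 < K)
    (hTK : ∀ x, ‖(T ^ K) x‖ ^ 2 ≤ ‖x‖ ^ 2 / 2) (hf : DifferentiableOn ℂ f (Metric.ball 0 1))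
    {ρ : ℝ} (hKρ : 1 - 1 / (16 * K) ≤ ρ) (hρ : ρ < 1) {p : ℝ} (hp : 1 ≤ p) :
    ‖∑' k, taylorCoeff f k • T ^ k‖ ^ p ≤
      √2 ^ p * (32 * K * Real.circleAverage (fun z => ‖f z‖ ^ p) 0 ρ) := by
  obtain ⟨A, hA, hAinv, hAT⟩ := exists_units_norm_conj_le hT hK hTK
  have hK1 : (1 : ℝ) ≤ K := by exact_mod_cast hK
  set δ : ℝ := 1 / (16 * K) with hδ
  have hδ0 : 0 < δ := by positivity
  have hδ1 : δ < 1 := by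
    rw [hδ, div_lt_one (by positivity)]
    linarith
  have hAT' : ‖(A * T * ↑A⁻¹ : E →L[ℂ] E)‖ ≤ (1 - δ) * ρ :=
    calc _ ≤ 1 - 2 * δ := hAT.trans_eq (by rw [hδ]; ring)
      _ ≤ (1 - δ) * (1 - δ) := by linarith [mul_self_nonneg δ]
      _ ≤ (1 - δ) * ρ := mul_le_mul_of_nonneg_left hKρ (by linarith)
  set V := ∑' k, taylorCoeff f k • (A * T * ↑A⁻¹ : E →L[ℂ] E) ^ k
  have hV : ‖∑' k, taylorCoeff f k • T ^ k‖ ≤ 1 * ‖V‖ * √2 :=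
    (norm_tsum_smul_pow_le_conj A T _).trans (by gcongr)
  calc _ ≤ (1 * ‖V‖ * √2) ^ p := by gcongr
    _ = √2 ^ p * ‖V‖ ^ p := by
      rw [one_mul, mul_comm, Real.mul_rpow (Real.sqrt_nonneg 2) (norm_nonneg V)]
    _ ≤ √2 ^ p * (2 / δ * Real.circleAverage (fun z => ‖f z‖ ^ p) 0 ρ) := by
      gcongr
      exact norm_tsum_taylorCoeff_smul_pow_rpow_le hf (by linarith) hρ hδ0 hAT' hp
    _ = _ := by
      rw [hδ]
      field_simp
      ring

end SpectralRadiusBound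

section CircleMean

/-- The `p`-th power mean of `|f|` over the circle of radius `ρ` about the origin. -/
def circleMean (p : ℝ) (f : ℂ → ℂ) (ρ : ℝ) : ℝ≥0∞ :=
  (ENNReal.ofReal (2 * Real.pi))⁻¹ *
    ∫⁻ θ in Set.Ioc 0 (2 * Real.pi), ‖f (circleMap 0 ρ θ)‖ₑ ^ p

lemma circleMean_eq_ofReal_circleAverage {f : ℂ → ℂ} {ρ : ℝ} (hρ : 0 ≤ ρ)
    (hf : ContinuousOn f (Metric.sphere 0 ρ)) {p : ℝ} (hp : 0 ≤ p) :
    circleMean p f ρ = ENNReal.ofReal (Real.circleAverage (fun z => ‖f z‖ ^ p) 0 ρ) := by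
  have hint : IntervalIntegrable (fun θ => ‖f (circleMap 0 ρ θ)‖ ^ p) volume 0 (2 * Real.pi) :=
    (hf.norm.rpow_const fun _ _ => .inr hp).circleIntegrable hρ
  rw [Real.circleAverage_def, smul_eq_mul, ENNReal.ofReal_mul (by positivity),
    ENNReal.ofReal_inv_of_pos Real.two_pi_pos, circleMean,
    intervalIntegral.integral_of_le Real.two_pi_pos.le,
    ofReal_integral_eq_lintegral_ofReal hint.1 (.of_forall fun θ => by positivity)]
  congr 1
  refine lintegral_congr fun θ => ?_
  rw [← ofReal_norm, ENNReal.ofReal_rpow_of_nonneg (norm_nonneg _) hp]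

end CircleMean

section Matrix

open scoped Matrix.Norms.L2Operator

variable {n : ℕ}

lemma toEuclideanCLM_funcCalc (f : ℂ → ℂ) (T : Matrix (Fin n) (Fin n) ℂ) :
    Matrix.toEuclideanCLM (n := Fin n) (𝕜 := ℂ) (funcCalc f T) =
      ∑' k, taylorCoeff f k • Matrix.toEuclideanCLM (n := Fin n) (𝕜 := ℂ) T ^ k := by
  set e := (Matrix.toEuclideanCLM (n := Fin n) (𝕜 := ℂ)).toAlgEquiv.toLinearEquiv
  have h : e (funcCalc f T) = ∑' k, e (taylorCoeff f k • T ^ k) :=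
    e.toContinuousLinearEquiv.map_tsum
  simp only [map_smul, e, AlgEquiv.toLinearEquiv_apply, map_pow] at h
  exact h

lemma sum_norm_pow_toEuclideanCLM_apply_sq_le {σ : Fin n → ℂ} {r : ℝ} (hr : r < 1)
    (hσ : ∀ i, ‖σ i‖ ≤ r) {T : Matrix (Fin n) (Fin n) ℂ} (hT : ‖T‖ ≤ 1)
    (hm : minpoly ℂ T = monicPoly σ) (K : ℕ) (x : EuclideanSpace ℂ (Fin n)) :
    ∑ k ∈ Finset.range K, ‖(Matrix.toEuclideanCLM (n := Fin n) (𝕜 := ℂ) T ^ k) x‖ ^ 2 ≤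
      2 * (n / (1 - r)) * ‖x‖ ^ 2 := by
  set S := Matrix.toEuclideanCLM (n := Fin n) (𝕜 := ℂ) T with hS
  have hprod : ((List.ofFn σ).map fun c => X - C c).prod = minpoly ℂ T := by
    rw [hm, monicPoly, List.map_ofFn, List.prod_ofFn]
    rfl
  have haeval : aeval S (minpoly ℂ T) = 0 := by
    have h := aeval_algHom_apply
      (Matrix.toEuclideanCLM (n := Fin n) (𝕜 := ℂ)).toAlgEquiv.toAlgHom T (minpoly ℂ T)
    rw [minpoly.aeval, map_zero] at h
    exact h
  calc _ ≤ (List.ofFn σ).length * (2 / (1 - r)) * ‖x‖ ^ 2 := by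
        refine sum_norm_pow_apply_sq_le (by rwa [hS, Matrix.l2_opNorm_toEuclideanCLM]) hr K _
          (by simpa only [List.mem_ofFn', Set.forall_mem_range] using hσ) x ?_
        rw [hprod, haeval, zero_apply]
    _ = _ := by
        rw [List.length_ofFn]
        ring

lemma norm_pow_toEuclideanCLM_apply_sq_le_half {σ : Fin n → ℂ} {r : ℝ} (hr : r < 1)
    (hσ : ∀ i, ‖σ i‖ ≤ r) {T : Matrix (Fin n) (Fin n) ℂ} (hT : ‖T‖ ≤ 1)
    (hm : minpoly ℂ T = monicPoly σ) {K : ℕ} (hK : 0 < K) (hnK : 4 * (n / (1 - r)) ≤ K)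
    (x : EuclideanSpace ℂ (Fin n)) :
    ‖(Matrix.toEuclideanCLM (n := Fin n) (𝕜 := ℂ) T ^ K) x‖ ^ 2 ≤ ‖x‖ ^ 2 / 2 :=
  norm_pow_apply_sq_le_half (by rwa [Matrix.l2_opNorm_toEuclideanCLM]) hK
    (by linarith) (sum_norm_pow_toEuclideanCLM_apply_sq_le hr hσ hT hm K x)

lemma one_le_div_one_sub (hn : 1 ≤ n) {r : ℝ} (hr0 : 0 ≤ r) (hr : r < 1) :
    1 ≤ (n : ℝ) / (1 - r) := by
  have hn' : (1 : ℝ) ≤ n := by exact_mod_cast hn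
  rw [le_div_iff₀ (by linarith)]
  linarith

theorem enorm_funcCalc_rpow_le {σ : Fin n → ℂ} (hn : 1 ≤ n) {r : ℝ} (hr0 : 0 ≤ r) (hr : r < 1)
    (hσ : ∀ i, ‖σ i‖ ≤ r) {T : Matrix (Fin n) (Fin n) ℂ} (hT : ‖T‖ ≤ 1)
    (hm : minpoly ℂ T = monicPoly σ) {f : ℂ → ℂ} (hf : DifferentiableOn ℂ f (Metric.ball 0 1))
    {ρ : ℝ} (hNρ : 1 - 1 / (80 * (n / (1 - r))) ≤ ρ) (hρ : ρ < 1) {p : ℝ} (hp : 1 ≤ p) :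
    ‖funcCalc f T‖ₑ ^ p ≤
      ENNReal.ofReal (√2 ^ p * 160 * (n / (1 - r))) * circleMean p f ρ := by
  set N : ℝ := n / (1 - r)
  have hN : 1 ≤ N := one_le_div_one_sub hn hr0 hr
  have hp0 : 0 ≤ p := zero_le_one.trans hp
  set K := ⌈4 * N⌉₊
  have hNK : 4 * N ≤ K := Nat.le_ceil _
  have hK : 0 < K := Nat.ceil_pos.2 (by positivity)
  have hKN : (K : ℝ) ≤ 5 * N := by linarith [Nat.ceil_lt_add_one (show 0 ≤ 4 * N by positivity)]
  have hKρ : 1 - 1 / (16 * (K : ℝ)) ≤ ρ := by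
    have := one_div_le_one_div_of_le (by positivity) (show 16 * (K : ℝ) ≤ 80 * N by linarith)
    linarith
  have hρ0 : 0 ≤ ρ := by
    have : 1 / (80 * N) ≤ 1 := (div_le_one (by positivity)).2 (by linarith)
    linarith
  have hcont : ContinuousOn f (Metric.sphere 0 ρ) := hf.continuousOn.mono
    (Metric.sphere_subset_closedBall.trans (Metric.closedBall_subset_ball hρ))
  have hbound := norm_tsum_taylorCoeff_smul_pow_rpow_le_of_pow
    (by rwa [Matrix.l2_opNorm_toEuclideanCLM]) hK
    (norm_pow_toEuclideanCLM_apply_sq_le_half hr hσ hT hm hK hNK) hf hKρ hρ hp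
  rw [← toEuclideanCLM_funcCalc, Matrix.l2_opNorm_toEuclideanCLM] at hbound
  rw [circleMean_eq_ofReal_circleAverage hρ0 hcont hp0, ← ENNReal.ofReal_mul (by positivity),
    ← ofReal_norm, ENNReal.ofReal_rpow_of_nonneg (norm_nonneg _) hp0]
  refine ENNReal.ofReal_le_ofReal (hbound.trans ?_)
  have havg : 0 ≤ Real.circleAverage (fun z => ‖f z‖ ^ p) 0 ρ :=
    Real.circleAverage_nonneg_of_nonneg fun _ _ => by positivity
  calc _ ≤ √2 ^ p * (32 * (5 * N) * Real.circleAverage (fun z => ‖f z‖ ^ p) 0 ρ) := by gcongr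
    _ = _ := by ring

end Matrix

section CircularMeans

variable {p β : ℝ} {f : ℂ → ℂ}

lemma hardyNorm_eq_iSup_circleMean (p : ℝ) (f : ℂ → ℂ) :
    hardyNorm p f = ⨆ ρ ∈ Set.Ico (0 : ℝ) 1, circleMean p f ρ ^ (1 / p) := rfl

lemma circleMean_congr {g : ℂ → ℂ} {ρ : ℝ} (h : Set.EqOn f g (Metric.sphere 0 |ρ|)) :
    circleMean p f ρ = circleMean p g ρ := by
  simp only [circleMean, h (circleMap_mem_sphere' 0 ρ _)]

lemma setLIntegral_Ioo_circleMap (g : ℂ → ℝ≥0∞) (s : ℝ) :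
    ∫⁻ θ in Set.Ioo (-Real.pi) Real.pi, g (circleMap 0 s θ) =
      ∫⁻ θ in Set.Ioc 0 (2 * Real.pi), g (circleMap 0 s θ) := by
  have hper : Function.Periodic (fun θ => g (circleMap 0 s θ)) (2 * Real.pi) := fun θ => by
    simp only [periodic_circleMap 0 s θ]
  have h := (isAddFundamentalDomain_Ioc Real.two_pi_pos (-Real.pi)).setLIntegral_eq
    (isAddFundamentalDomain_Ioc Real.two_pi_pos 0) (fun θ => g (circleMap 0 s θ))
    hper.map_vadd_zmultiples
  rw [zero_add, (by ring : -Real.pi + 2 * Real.pi = Real.pi)] at h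
  rw [← h]
  exact setLIntegral_congr Ioo_ae_eq_Ioc

lemma lintegral_eq_lintegral_circleMap {g : ℂ → ℝ≥0∞} (hg : Measurable g) :
    ∫⁻ z, g z = ∫⁻ s in Set.Ioi (0 : ℝ),
      ENNReal.ofReal s * ∫⁻ θ in Set.Ioc 0 (2 * Real.pi), g (circleMap 0 s θ) := by
  have hsymm : ∀ q : ℝ × ℝ, Complex.polarCoord.symm q = circleMap 0 q.1 q.2 := fun q => by
    rw [Complex.polarCoord_symm_apply, circleMap_zero, Complex.exp_mul_I, Complex.ofReal_cos,
      Complex.ofReal_sin]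
  have hmeas : Measurable fun q : ℝ × ℝ => ENNReal.ofReal q.1 * g (circleMap 0 q.1 q.2) := by
    simp only [circleMap]
    fun_prop
  rw [← Complex.lintegral_comp_polarCoord_symm]
  simp only [hsymm, smul_eq_mul]
  rw [polarCoord_target, Measure.volume_eq_prod, setLIntegral_prod _
    hmeas.aemeasurable]
  refine lintegral_congr fun s => ?_
  rw [lintegral_const_mul' _ _ ENNReal.ofReal_ne_top, setLIntegral_Ioo_circleMap]

lemma setLIntegral_ball_eq_lintegral_circleMap {g : ℂ → ℝ≥0∞} (hg : Measurable g) :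
    ∫⁻ z in Metric.ball 0 1, g z = ∫⁻ s in Set.Ioo (0 : ℝ) 1,
      ENNReal.ofReal s * ∫⁻ θ in Set.Ioc 0 (2 * Real.pi), g (circleMap 0 s θ) := by
  rw [← lintegral_indicator Metric.isOpen_ball.measurableSet,
    lintegral_eq_lintegral_circleMap (hg.indicator Metric.isOpen_ball.measurableSet),
    ← Set.Iio_inter_Ioi, ← setLIntegral_indicator measurableSet_Iio]
  refine setLIntegral_congr_fun measurableSet_Ioi fun s (hs : 0 < s) => ?_
  have hmem : ∀ θ, circleMap 0 s θ ∈ Metric.ball (0 : ℂ) 1 ↔ s ∈ Set.Iio 1 := fun θ => by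
    rw [mem_ball_zero_iff, norm_circleMap_zero, abs_of_pos hs, Set.mem_Iio]
  by_cases h : s ∈ Set.Iio 1
  · simp only [Set.indicator, hmem, h, if_true]
  · simp only [Set.indicator, hmem, h, if_false, lintegral_zero, mul_zero]

lemma setLIntegral_Ioo_comp_one_sub_sq (g : ℝ → ℝ≥0∞) :
    ∫⁻ s in Set.Ioo (0 : ℝ) 1, ENNReal.ofReal (2 * s) * g (1 - s ^ 2) =
      ∫⁻ t in Set.Ioo (0 : ℝ) 1, g t := by
  have himage : (fun s : ℝ => 1 - s ^ 2) '' Set.Ioo 0 1 = Set.Ioo 0 1 := by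
    ext t
    constructor
    · rintro ⟨s, ⟨hs0, hs1⟩, rfl⟩
      exact ⟨by nlinarith, by nlinarith⟩
    · rintro ⟨ht0, ht1⟩
      refine ⟨√(1 - t), ⟨Real.sqrt_pos.2 (by linarith), ?_⟩, ?_⟩
      · rw [Real.sqrt_lt' one_pos]
        linarith
      · simp only [Real.sq_sqrt (sub_nonneg.2 ht1.le), sub_sub_cancel]
  have hinj : Set.InjOn (fun s : ℝ => 1 - s ^ 2) (Set.Ioo 0 1) := fun s hs t ht h =>
    (sq_eq_sq₀ hs.1.le ht.1.le).1 (sub_right_injective h)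
  have hderiv : ∀ s ∈ Set.Ioo (0 : ℝ) 1,
      HasDerivWithinAt (fun s : ℝ => 1 - s ^ 2) (-(2 * s)) (Set.Ioo 0 1) s := fun s _ => by
    simpa using ((hasDerivAt_pow 2 s).const_sub 1).hasDerivWithinAt
  conv_rhs =>
    rw [← himage, lintegral_image_eq_lintegral_abs_deriv_mul measurableSet_Ioo hderiv hinj]
  refine setLIntegral_congr_fun measurableSet_Ioo fun s hs => ?_
  simp only [abs_neg, abs_of_pos (mul_pos two_pos hs.1)]

lemma setLIntegral_ball_mul_eq_lintegral_circleMean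
    (hf : ContinuousOn f (Metric.ball 0 1)) (p β : ℝ) :
    (ENNReal.ofReal Real.pi)⁻¹ *
        ∫⁻ z in Metric.ball (0 : ℂ) 1, ‖f z‖ₑ ^ p * ENNReal.ofReal ((1 - ‖z‖ ^ 2) ^ β) =
      ∫⁻ t in Set.Ioo (0 : ℝ) 1, ENNReal.ofReal (t ^ β) * circleMean p f √(1 - t) := by
  classical
  set F := (Metric.ball (0 : ℂ) 1).indicator f
  have hF : Measurable F := by
    simp only [F, ← Set.piecewise_eq_indicator]
    exact hf.measurable_piecewise continuousOn_const Metric.isOpen_ball.measurableSet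
  have hFf : Set.EqOn F f (Metric.ball 0 1) := Set.eqOn_indicator
  have hball : ∫⁻ z in Metric.ball (0 : ℂ) 1, ‖f z‖ₑ ^ p * ENNReal.ofReal ((1 - ‖z‖ ^ 2) ^ β) =
      ∫⁻ z in Metric.ball (0 : ℂ) 1, ‖F z‖ₑ ^ p * ENNReal.ofReal ((1 - ‖z‖ ^ 2) ^ β) :=
    setLIntegral_congr_fun Metric.isOpen_ball.measurableSet fun z hz => by simp only [hFf hz]
  rw [hball, setLIntegral_ball_eq_lintegral_circleMap (by fun_prop),
    ← setLIntegral_Ioo_comp_one_sub_sq fun t => ENNReal.ofReal (t ^ β) * circleMean p f √(1 - t),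
    ← lintegral_const_mul' _ _
      (ENNReal.inv_ne_top.2 (ENNReal.ofReal_pos.2 Real.pi_pos).ne')]
  refine setLIntegral_congr_fun measurableSet_Ioo fun s ⟨hs0, hs1⟩ => ?_
  have hsphere : Metric.sphere (0 : ℂ) |s| ⊆ Metric.ball 0 1 := fun z hz => by
    rwa [mem_ball_zero_iff, mem_sphere_zero_iff_norm.1 hz, abs_of_pos hs0]
  simp only [norm_circleMap_zero, sq_abs]
  rw [lintegral_mul_const' _ _ ENNReal.ofReal_ne_top, sub_sub_cancel, Real.sqrt_sq hs0.le,
    ← circleMean_congr (hFf.mono hsphere), circleMean, ← ENNReal.ofReal_inv_of_pos Real.pi_pos,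
    ← ENNReal.ofReal_inv_of_pos Real.two_pi_pos]
  have hconst : ENNReal.ofReal Real.pi⁻¹ * ENNReal.ofReal s =
      ENNReal.ofReal (2 * s) * ENNReal.ofReal (2 * Real.pi)⁻¹ := by
    rw [← ENNReal.ofReal_mul (by positivity), ← ENNReal.ofReal_mul (by positivity)]
    congr 1
    field_simp
  rw [← mul_assoc, hconst]
  ring

lemma bergmanNorm_eq_lintegral_circleMean (hf : ContinuousOn f (Metric.ball 0 1)) (p β : ℝ) :
    bergmanNorm p β f =
      (∫⁻ t in Set.Ioo (0 : ℝ) 1,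
        ENNReal.ofReal (t ^ β) * circleMean p f √(1 - t)) ^ (1 / p) := by
  rw [bergmanNorm, setLIntegral_ball_mul_eq_lintegral_circleMean hf]

lemma setLIntegral_Ioo_rpow (hβ : -1 < β) {h : ℝ} (hh : 0 ≤ h) :
    ∫⁻ t in Set.Ioo 0 h, ENNReal.ofReal (t ^ β) = ENNReal.ofReal (h ^ (β + 1) / (β + 1)) := by
  have hint := integral_rpow (a := 0) (b := h) (.inl hβ)
  rw [Real.zero_rpow (by linarith), sub_zero, intervalIntegral.integral_of_le hh] at hint
  rw [setLIntegral_congr Ioo_ae_eq_Ioc, ← hint, ofReal_integral_eq_lintegral_ofReal]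
  · exact (intervalIntegral.intervalIntegrable_rpow' hβ).1
  · refine (ae_restrict_iff' measurableSet_Ioc).2 (.of_forall fun t ht => ?_)
    exact Real.rpow_nonneg ht.1.le β

lemma rpow_one_div_le_one_iff {x : ℝ≥0∞} (hp : 0 < p) : x ^ (1 / p) ≤ 1 ↔ x ≤ 1 := by
  rw [← ENNReal.one_rpow (1 / p), ENNReal.rpow_le_rpow_iff (by positivity), ENNReal.one_rpow]

end CircularMeans

section UpperBounds

variable {p β : ℝ} {f : ℂ → ℂ}

lemma circleMean_le_one_of_hardyNorm_le_one (hp : 0 < p) (hN : hardyNorm p f ≤ 1) {ρ : ℝ}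
    (hρ : ρ ∈ Set.Ico (0 : ℝ) 1) : circleMean p f ρ ≤ 1 := by
  rw [hardyNorm_eq_iSup_circleMean, iSup₂_le_iff] at hN
  exact (rpow_one_div_le_one_iff hp).1 (hN ρ hρ)

lemma ofReal_mul_le_of_le_mul_circleMean (hf : ContinuousOn f (Metric.ball 0 1))
    (hp : 0 < p) (hβ : -1 < β) (hN : bergmanNorm p β f ≤ 1) {y K : ℝ≥0∞} (hK : K ≠ ∞) {h : ℝ}
    (hh0 : 0 ≤ h) (hh1 : h ≤ 1)
    (hy : ∀ ρ, 1 - h ≤ ρ → ρ < 1 → y ≤ K * circleMean p f ρ) :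
    ENNReal.ofReal (h ^ (β + 1) / (β + 1)) * y ≤ K := by
  rw [bergmanNorm_eq_lintegral_circleMean hf, rpow_one_div_le_one_iff hp] at hN
  have hpoint : ∀ t ∈ Set.Ioo 0 h, ENNReal.ofReal (t ^ β) * y ≤
      K * (ENNReal.ofReal (t ^ β) * circleMean p f √(1 - t)) := fun t ⟨ht0, hth⟩ => by
    rw [mul_left_comm]
    gcongr
    refine hy _ ?_ ((Real.sqrt_lt' one_pos).2 (by linarith))
    exact (by linarith : 1 - h ≤ 1 - t).trans (Real.le_sqrt_of_sq_le (by nlinarith))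
  calc ENNReal.ofReal (h ^ (β + 1) / (β + 1)) * y
      = ∫⁻ t in Set.Ioo 0 h, ENNReal.ofReal (t ^ β) * y := by
        rw [lintegral_mul_const _ (by fun_prop), setLIntegral_Ioo_rpow hβ hh0]
    _ ≤ ∫⁻ t in Set.Ioo 0 h, K * (ENNReal.ofReal (t ^ β) * circleMean p f √(1 - t)) :=
        setLIntegral_mono' measurableSet_Ioo hpoint
    _ ≤ ∫⁻ t in Set.Ioo 0 1, K * (ENNReal.ofReal (t ^ β) * circleMean p f √(1 - t)) :=
        lintegral_mono_set (Set.Ioo_subset_Ioo_right hh1)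
    _ ≤ K := by
        rw [lintegral_const_mul' _ _ hK]
        exact mul_le_of_le_one_right' hN

lemma le_ofReal_rpow_of_rpow_le {x : ℝ≥0∞} {C N e : ℝ} (hp : 0 < p) (hC : 0 ≤ C) (hN : 0 ≤ N)
    (h : x ^ p ≤ ENNReal.ofReal (C * N ^ e)) :
    x ≤ ENNReal.ofReal (C ^ (1 / p) * N ^ (e / p)) := by
  rw [← ENNReal.rpow_le_rpow_iff hp, ENNReal.ofReal_rpow_of_nonneg (by positivity) hp.le,
    Real.mul_rpow (by positivity) (by positivity), ← Real.rpow_mul hC, ← Real.rpow_mul hN,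
    one_div_mul_cancel hp.ne', Real.rpow_one, div_mul_cancel₀ _ hp.ne']
  exact h

variable {n : ℕ} {r : ℝ}

open scoped Matrix.Norms.L2Operator

lemma supPtakYoung_le {ν : (ℂ → ℂ) → ℝ≥0∞} {B : ℝ≥0∞}
    (h : ∀ f, DifferentiableOn ℂ f (Metric.ball 0 1) → ν f ≤ 1 → ∀ σ : Fin n → ℂ,
      (∀ i, ‖σ i‖ ≤ r) → ∀ T : Matrix (Fin n) (Fin n) ℂ, ‖T‖ ≤ 1 →
        minpoly ℂ T = monicPoly σ → ‖funcCalc f T‖ₑ ≤ B) :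
    supPtakYoung ν n r ≤ B :=
  iSup₂_le fun f hf => iSup₂_le fun hν σ => iSup₂_le fun _ hσ => iSup₂_le fun T hT =>
    iSup_le fun hm => h f hf hν σ hσ T hT hm

theorem supPtakYoung_hardyNorm_le (hp : 1 ≤ p) (hn : 1 ≤ n) (hr0 : 0 ≤ r) (hr : r < 1) :
    supPtakYoung (hardyNorm p) n r ≤
      ENNReal.ofReal ((√2 ^ p * 160) ^ (1 / p) * ((n : ℝ) / (1 - r)) ^ (1 / p)) := by
  have hp0 : 0 < p := zero_lt_one.trans_le hp
  have hN1 := one_le_div_one_sub hn hr0 hr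
  refine supPtakYoung_le fun f hf hν σ hσ T hT hm =>
    le_ofReal_rpow_of_rpow_le hp0 (by positivity) (by positivity) ?_
  have hρ : 1 - 1 / (80 * (n / (1 - r))) ∈ Set.Ico (0 : ℝ) 1 := by
    have hpos : 0 < 1 / (80 * (n / (1 - r))) := by positivity
    have hle : 1 / (80 * (n / (1 - r))) ≤ 1 := (div_le_one (by positivity)).2 (by linarith)
    exact ⟨by linarith, by linarith⟩
  calc ‖funcCalc f T‖ₑ ^ p
      ≤ ENNReal.ofReal (√2 ^ p * 160 * (n / (1 - r))) * circleMean p f _ :=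
        enorm_funcCalc_rpow_le hn hr0 hr hσ hT hm hf le_rfl hρ.2 hp
    _ ≤ ENNReal.ofReal (√2 ^ p * 160 * (n / (1 - r)) ^ (1 : ℝ)) := by
        rw [Real.rpow_one]
        exact mul_le_of_le_one_right' (circleMean_le_one_of_hardyNorm_le_one hp0 hν hρ)

theorem supPtakYoung_bergmanNorm_le (hp : 1 ≤ p) (hβ : -1 < β) (hn : 1 ≤ n) (hr0 : 0 ≤ r)
    (hr : r < 1) :
    supPtakYoung (bergmanNorm p β) n r ≤
      ENNReal.ofReal ((√2 ^ p * 160 * ((β + 1) * 80 ^ (β + 1))) ^ (1 / p) *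
        ((n : ℝ) / (1 - r)) ^ ((2 + β) / p)) := by
  have hp0 : 0 < p := zero_lt_one.trans_le hp
  have hβ1 : 0 < β + 1 := by linarith
  have hN1 := one_le_div_one_sub hn hr0 hr
  refine supPtakYoung_le fun f hf hν σ hσ T hT hm =>
    le_ofReal_rpow_of_rpow_le hp0 (by positivity) (by positivity) ?_
  set N : ℝ := n / (1 - r)
  have h : ENNReal.ofReal ((1 / (80 * N)) ^ (β + 1) / (β + 1)) * ‖funcCalc f T‖ₑ ^ p ≤
      ENNReal.ofReal (√2 ^ p * 160 * N) :=
    ofReal_mul_le_of_le_mul_circleMean hf.continuousOn hp0 hβ hν ENNReal.ofReal_ne_top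
      (by positivity) ((div_le_one (by positivity)).2 (by linarith))
      fun ρ hNρ hρ => enorm_funcCalc_rpow_le hn hr0 hr hσ hT hm hf hNρ hρ hp
  have hweight : 0 < (1 / (80 * N)) ^ (β + 1) / (β + 1) := by positivity
  rw [mul_comm, ← ENNReal.le_div_iff_mul_le (.inl (ENNReal.ofReal_pos.2 hweight).ne')
    (.inl ENNReal.ofReal_ne_top), ← ENNReal.ofReal_div_of_pos hweight] at h
  refine h.trans_eq (congrArg _ ?_)
  have hNpow : N ^ (2 + β) = N * N ^ (β + 1) := by
    rw [(by ring : 2 + β = 1 + (β + 1)), Real.rpow_add (by positivity), Real.rpow_one]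
  rw [hNpow, one_div, Real.inv_rpow (by positivity), Real.mul_rpow (by norm_num) (by positivity)]
  field_simp

end UpperBounds

section Toeplitz

open scoped PowerSeries

variable {R : Type*} [CommRing R] {n : ℕ}

lemma sum_fin_coeff_mul_coeff (p q : R⟦X⟧) (i : Fin n) :
    ∑ k : Fin n, PowerSeries.coeff i (PowerSeries.X ^ (k : ℕ) * p) * PowerSeries.coeff k q =
      PowerSeries.coeff i (p * q) := by
  rw [Fin.sum_univ_eq_sum_range fun k =>
      PowerSeries.coeff (i : ℕ) (PowerSeries.X ^ k * p) * PowerSeries.coeff k q,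
    mul_comm p q, PowerSeries.coeff_mul, Finset.Nat.sum_antidiagonal_eq_sum_range_succ_mk,
    ← Finset.sum_subset (Finset.range_subset_range.2 i.2)]
  · refine Finset.sum_congr rfl fun k hk => ?_
    rw [PowerSeries.coeff_X_pow_mul', if_pos (Finset.mem_range_succ_iff.1 hk), mul_comm]
  · intro k _ hk
    rw [PowerSeries.coeff_X_pow_mul', if_neg (by simpa [Nat.lt_succ_iff] using hk), zero_mul]

variable (n) in
/-- The lower triangular Toeplitz matrix of a power series: the matrix of multiplication by the
series on `R⟦X⟧ / (X ^ n)` in the basis `1, X, …, X ^ (n - 1)`. -/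
def toeplitz : R⟦X⟧ →ₐ[R] Matrix (Fin n) (Fin n) R :=
  AlgHom.ofLinearMap
    { toFun q := Matrix.of fun i j => PowerSeries.coeff i (PowerSeries.X ^ (j : ℕ) * q)
      map_add' p q := by
        ext
        simp [mul_add]
      map_smul' c q := by
        ext
        simp }
    (by
      ext i j
      simp [PowerSeries.coeff_X_pow, Matrix.one_apply, Fin.ext_iff])
    (fun p q => by
      ext i j
      simp only [LinearMap.coe_mk, AddHom.coe_mk, Matrix.of_apply, Matrix.mul_apply]
      rw [sum_fin_coeff_mul_coeff, mul_left_comm])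

lemma toeplitz_apply (q : R⟦X⟧) (i j : Fin n) :
    toeplitz n q i j = PowerSeries.coeff i (PowerSeries.X ^ (j : ℕ) * q) := rfl

lemma toeplitz_eq_zero_iff {q : R⟦X⟧} : toeplitz n q = 0 ↔ PowerSeries.X ^ n ∣ q := by
  rw [PowerSeries.X_pow_dvd_iff]
  constructor
  · intro h m hm
    simpa [toeplitz_apply] using congrFun₂ h ⟨m, hm⟩ ⟨0, by omega⟩
  · intro h
    ext i j
    rw [toeplitz_apply, PowerSeries.coeff_X_pow_mul', Matrix.zero_apply]
    split_ifs
    · exact h _ (by omega)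
    · rfl

lemma minpoly_toeplitz {K : Type*} [Field K] {q : K⟦X⟧} {c : K}
    (hq : (q - PowerSeries.C c).order = 1) :
    minpoly K (toeplitz n q) = (X - C c) ^ n := by
  have haeval : ∀ m : ℕ, aeval (toeplitz n q) ((X - C c) ^ m) = 0 ↔ n ≤ m := fun m => by
    have hsub : aeval q ((X - C c) ^ m) = (q - PowerSeries.C c) ^ m := by
      rw [map_pow, map_sub, aeval_X, aeval_C]
      rfl
    rw [aeval_algHom_apply, hsub, toeplitz_eq_zero_iff, pow_dvd_iff_le_emultiplicity,
      ← PowerSeries.order_eq_emultiplicity_X, PowerSeries.order_pow, hq, nsmul_one, Nat.cast_le]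
  obtain ⟨m, hmn, hassoc⟩ := (dvd_prime_pow (prime_X_sub_C c) _).1
    (minpoly.dvd K (toeplitz n q) ((haeval n).2 le_rfl))
  have hm : minpoly K (toeplitz n q) = (X - C c) ^ m :=
    eq_of_monic_of_associated (minpoly.monic (Matrix.isIntegral _)) ((monic_X_sub_C c).pow m)
      hassoc
  rw [hm, hmn.antisymm ((haeval m).1 (hm ▸ minpoly.aeval K _))]

lemma sum_toeplitz_apply (q : R⟦X⟧) (i : Fin n) :
    ∑ j, toeplitz n q i j = ∑ k ∈ Finset.range (i + 1), PowerSeries.coeff k q := by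
  have h := sum_fin_coeff_mul_coeff q (PowerSeries.mk 1) i
  simp only [PowerSeries.coeff_mk, Pi.one_apply, mul_one] at h
  simp only [toeplitz_apply]
  rw [h, PowerSeries.coeff_mul, Finset.Nat.sum_antidiagonal_eq_sum_range_succ_mk]
  simp only [PowerSeries.coeff_mk, Pi.one_apply, mul_one]

end Toeplitz

section ToeplitzNorm

open scoped PowerSeries Matrix.Norms.L2Operator

variable {n : ℕ}

lemma norm_toeplitz_X_le_one : ‖toeplitz n (PowerSeries.X : ℂ⟦X⟧)‖ ≤ 1 := by
  have happly : ∀ i j : Fin n,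
      toeplitz n (PowerSeries.X : ℂ⟦X⟧) i j = if (i : ℕ) = j + 1 then 1 else 0 := fun i j => by
    rw [toeplitz_apply, ← pow_succ, PowerSeries.coeff_X_pow]
  set S := toeplitz n (PowerSeries.X : ℂ⟦X⟧)
  have hdiag : S.conjTranspose * S =
      Matrix.diagonal fun j : Fin n => if (j : ℕ) + 1 < n then 1 else 0 := by
    ext i j
    simp only [Matrix.mul_apply, Matrix.conjTranspose_apply, happly, Matrix.diagonal_apply,
      apply_ite star, star_one, star_zero, ite_mul, one_mul, zero_mul]
    by_cases hi : (i : ℕ) + 1 < n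
    · rw [Finset.sum_eq_single_of_mem (⟨i + 1, hi⟩ : Fin n) (Finset.mem_univ _)
        fun k _ hk => if_neg fun h => hk (Fin.ext h)]
      simp [hi, Fin.ext_iff]
    · rw [Finset.sum_eq_zero fun k _ => if_neg (by omega), if_neg hi, ite_self]
  have hle : ‖S‖ * ‖S‖ ≤ 1 := by
    rw [← Matrix.l2_opNorm_conjTranspose_mul_self, hdiag, Matrix.l2_opNorm_diagonal,
      pi_norm_le_iff_of_nonneg zero_le_one]
    intro i
    split_ifs <;> simp
  nlinarith [norm_nonneg S]

lemma norm_sum_sum_le (A : Matrix (Fin n) (Fin n) ℂ) : ‖∑ i, ∑ j, A i j‖ ≤ n * ‖A‖ := by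
  set u : EuclideanSpace ℂ (Fin n) := WithLp.toLp 2 1 with hu
  have hnorm : ‖u‖ ^ 2 = n := by
    rw [EuclideanSpace.norm_sq_eq]
    simp [hu]
  have hinner : ∑ i, ∑ j, A i j = ⟪u, WithLp.toLp 2 (A.mulVec 1)⟫_ℂ := by
    simp [PiLp.inner_apply, hu, Matrix.mulVec, dotProduct]
  calc ‖∑ i, ∑ j, A i j‖ ≤ ‖u‖ * ‖WithLp.toLp 2 (A.mulVec 1)‖ :=
        hinner ▸ norm_inner_le_norm _ _
    _ ≤ ‖u‖ * (‖A‖ * ‖u‖) := by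
        gcongr
        exact Matrix.l2_opNorm_mulVec A u
    _ = n * ‖A‖ := by
        rw [← hnorm]
        ring

lemma sum_coeff_le_mul_norm_toeplitz (q : ℝ⟦X⟧) :
    ∑ i : Fin n, ∑ k ∈ Finset.range (i + 1), PowerSeries.coeff k q ≤
      n * ‖toeplitz n (q.map Complex.ofRealHom)‖ := by
  refine le_trans ?_ (norm_sum_sum_le _)
  simp only [sum_toeplitz_apply, PowerSeries.coeff_map, Complex.ofRealHom_eq_coe,
    ← Complex.ofReal_sum, Complex.norm_real]
  exact Real.le_norm_self _

lemma pow_div_le_norm_toeplitz {q : ℝ⟦X⟧} {c : ℝ} (hc : 0 ≤ c) {m : ℕ}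
    (hq : ∀ k < n, c * ((k + m).choose m : ℝ) ≤ PowerSeries.coeff k q) :
    c * (n : ℝ) ^ (m + 1) / (m + 2).factorial ≤
      ‖toeplitz n (q.map Complex.ofRealHom)‖ := by
  rcases n.eq_zero_or_pos with rfl | hn
  · simp
  have hchoose : ∑ i : Fin n, ∑ k ∈ Finset.range (i + 1), ((k + m).choose m : ℝ) =
      ((n + m + 1).choose (m + 2) : ℝ) := by
    obtain ⟨l, rfl⟩ := Nat.exists_eq_add_one.2 hn
    rw [Fin.sum_univ_eq_sum_range fun i => ∑ k ∈ Finset.range (i + 1), ((k + m).choose m : ℝ)]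
    simp only [← Nat.cast_sum, Nat.sum_range_add_choose]
    have h := Nat.sum_range_add_choose l (m + 1)
    simp only [← add_assoc] at h
    rw [h, add_right_comm l 1 m]
  have hpow : (n : ℝ) ^ (m + 2) / (m + 2).factorial ≤ ((n + m + 1).choose (m + 2) : ℝ) := by
    have h := Nat.pow_le_choose (α := ℝ) (m + 2) (n + m + 1)
    rwa [(by omega : n + m + 1 + 1 - (m + 2) = n)] at h
  have hn' : (0 : ℝ) < n := by exact_mod_cast hn
  refine le_of_mul_le_mul_left ?_ hn'
  calc n * (c * (n : ℝ) ^ (m + 1) / (m + 2).factorial)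
      = c * ((n : ℝ) ^ (m + 2) / (m + 2).factorial) := by ring
    _ ≤ c * ∑ i : Fin n, ∑ k ∈ Finset.range (i + 1), ((k + m).choose m : ℝ) := by
        rw [hchoose]
        gcongr
    _ ≤ ∑ i : Fin n, ∑ k ∈ Finset.range (i + 1), PowerSeries.coeff k q := by
        simp only [Finset.mul_sum]
        refine Finset.sum_le_sum fun i _ => Finset.sum_le_sum fun k hk => hq k ?_
        exact (Finset.mem_range_succ_iff.1 hk).trans_lt i.2
    _ ≤ _ := sum_coeff_le_mul_norm_toeplitz q

end ToeplitzNorm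

section Moebius

open scoped PowerSeries Matrix.Norms.L2Operator

variable {n : ℕ} {c : ℂ}

/-- The power series of the disc automorphism `z ↦ (z + c) / (1 + conj c * z)`. -/
def moebiusSeries (c : ℂ) : ℂ⟦X⟧ :=
  (PowerSeries.X + PowerSeries.C c) * (1 + PowerSeries.C (conj c) * PowerSeries.X)⁻¹

lemma moebiusSeries_mul (c : ℂ) :
    moebiusSeries c * (1 + PowerSeries.C (conj c) * PowerSeries.X) =
      PowerSeries.X + PowerSeries.C c := by
  rw [moebiusSeries, mul_assoc, PowerSeries.inv_mul_cancel _ (by simp), mul_one]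

lemma order_moebiusSeries_sub (hc : ‖c‖ < 1) :
    (moebiusSeries c - PowerSeries.C c).order = 1 := by
  have hmul : (moebiusSeries c - PowerSeries.C c) *
      (1 + PowerSeries.C (conj c) * PowerSeries.X) =
        PowerSeries.C (1 - c * conj c) * PowerSeries.X := by
    rw [sub_mul, moebiusSeries_mul, map_sub, map_mul, map_one]
    ring
  have hne : 1 - c * conj c ≠ 0 := by
    rw [Complex.mul_conj', sub_ne_zero]
    exact_mod_cast (by nlinarith [norm_nonneg c] : ‖c‖ ^ 2 < 1).ne'
  have hden : (1 + PowerSeries.C (conj c) * PowerSeries.X).order = 0 :=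
    PowerSeries.order_zero_of_unit (by simp [PowerSeries.isUnit_iff_constantCoeff])
  have hconst : (PowerSeries.C (1 - c * conj c)).order = 0 :=
    PowerSeries.order_zero_of_unit ((isUnit_iff_ne_zero.2 hne).map PowerSeries.C)
  simpa only [PowerSeries.order_mul, PowerSeries.order_X, hden, hconst, add_zero, zero_add]
    using congrArg PowerSeries.order hmul

lemma minpoly_toeplitz_moebiusSeries (hc : ‖c‖ < 1) :
    minpoly ℂ (toeplitz n (moebiusSeries c)) = monicPoly fun _ : Fin n => c := by
  rw [minpoly_toeplitz (order_moebiusSeries_sub hc), monicPoly, Finset.prod_const,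
    Finset.card_univ, Fintype.card_fin]

lemma norm_toeplitz_moebiusSeries_le_one (hc : ‖c‖ < 1) :
    ‖toeplitz n (moebiusSeries c)‖ ≤ 1 := by
  set Φ := Matrix.toEuclideanCLM (n := Fin n) (𝕜 := ℂ)
  have hmul := congrArg (fun q => Φ (toeplitz n q)) (moebiusSeries_mul c)
  simp only [← PowerSeries.smul_eq_C_mul, map_mul, map_add, map_one, map_smul] at hmul
  rw [← Matrix.l2_opNorm_toEuclideanCLM]
  refine norm_le_one_of_mul_one_sub_eq (T := Φ (toeplitz n PowerSeries.X)) (c := -c) ?_ ?_ ?_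
  · rw [Matrix.l2_opNorm_toEuclideanCLM]
    exact norm_toeplitz_X_le_one
  · rwa [norm_neg]
  · rw [map_neg, neg_smul, neg_smul, sub_neg_eq_add, sub_neg_eq_add, hmul,
      ← mul_one (PowerSeries.C c), ← PowerSeries.smul_eq_C_mul, map_smul, map_smul, map_one,
      map_one]

end Moebius

section Peak

open scoped PowerSeries Matrix.Norms.L2Operator

variable {n m : ℕ} {c r κ ρ : ℝ}

/-- A test function peaking at the boundary point `1`, at distance of order `1 - ρ` from its
pole. -/
def peak (c ρ : ℝ) (m : ℕ) (z : ℂ) : ℂ := c * (1 / (1 - ρ * z) ^ (m + 1))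

lemma norm_ofReal_mul_lt_one (hρ0 : 0 ≤ ρ) (hρ : ρ < 1) {z : ℂ} (hz : ‖z‖ < 1) :
    ‖(ρ : ℂ) * z‖ < 1 := by
  rw [norm_mul, Complex.norm_real, Real.norm_of_nonneg hρ0]
  nlinarith [norm_nonneg z]

lemma hasSum_peak (c : ℝ) (hρ0 : 0 ≤ ρ) (hρ : ρ < 1) (m : ℕ) {z : ℂ} (hz : ‖z‖ < 1) :
    HasSum (fun k : ℕ => c * (((k + m).choose m : ℂ) * ρ ^ k) * z ^ k) (peak c ρ m z) :=
  ((hasSum_choose_mul_geometric_of_norm_lt_one m (norm_ofReal_mul_lt_one hρ0 hρ hz)).mul_left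
    (c : ℂ)).congr_fun fun k => by ring

lemma differentiableOn_peak (c : ℝ) (hρ0 : 0 ≤ ρ) (hρ : ρ < 1) (m : ℕ) :
    DifferentiableOn ℂ (peak c ρ m) (Metric.ball 0 1) := by
  intro z hz
  have hne : (1 - (ρ : ℂ) * z) ^ (m + 1) ≠ 0 := pow_ne_zero _ <| sub_ne_zero.2 fun h =>
    (norm_ofReal_mul_lt_one hρ0 hρ (mem_ball_zero_iff.1 hz)).ne (by rw [← h, norm_one])
  unfold peak
  fun_prop (disch := assumption)

lemma taylorCoeff_peak (c : ℝ) (hρ0 : 0 ≤ ρ) (hρ : ρ < 1) (m k : ℕ) :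
    taylorCoeff (peak c ρ m) k = c * (((k + m).choose m : ℂ) * ρ ^ k) := by
  have hanalytic : AnalyticAt ℂ (peak c ρ m) 0 :=
    (differentiableOn_peak c hρ0 hρ m).analyticAt (Metric.ball_mem_nhds 0 one_pos)
  have hseries : HasFPowerSeriesAt (peak c ρ m) (FormalMultilinearSeries.ofScalars ℂ
      fun k : ℕ => (c : ℂ) * (((k + m).choose m : ℂ) * ρ ^ k)) 0 := by
    rw [hasFPowerSeriesAt_iff]
    filter_upwards [Metric.ball_mem_nhds (0 : ℂ) one_pos] with z hz
    rw [zero_add]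
    refine (hasSum_peak c hρ0 hρ m (mem_ball_zero_iff.1 hz)).congr_fun fun k => ?_
    rw [FormalMultilinearSeries.coeff_ofScalars, smul_eq_mul, mul_comm]
  have h := congrArg (fun q => FormalMultilinearSeries.coeff q k)
    (hanalytic.hasFPowerSeriesAt.eq_formalMultilinearSeries hseries)
  rw [taylorCoeff]
  simpa only [FormalMultilinearSeries.coeff_ofScalars] using h

lemma funcCalc_peak (c : ℝ) (hρ0 : 0 ≤ ρ) (hρ : ρ < 1) {T V : Matrix (Fin n) (Fin n) ℂ}
    (hT : ‖T‖ ≤ 1) (hV : (1 - (ρ : ℂ) • T) ^ (m + 1) * V = 1) :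
    funcCalc (peak c ρ m) T = (c : ℂ) • V := by
  have hlt : ‖(ρ : ℂ) • T‖ < 1 := by
    rw [norm_smul, Complex.norm_real, Real.norm_of_nonneg hρ0]
    exact (mul_le_of_le_one_right hρ0 hT).trans_lt hρ
  have hinv : Ring.inverse (1 - (ρ : ℂ) • T) ^ (m + 1) = V := by
    rw [Ring.inverse_pow, ← Matrix.nonsing_inv_eq_ringInverse, Matrix.inv_eq_right_inv hV]
  have h := (hasSum_choose_mul_geometric_of_norm_lt_one' m hlt).const_smul (c : ℂ)
  rw [← hinv, ← h.tsum_eq, funcCalc]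
  refine tsum_congr fun k => ?_
  rw [← taylorCoeff, taylorCoeff_peak c hρ0 hρ, _root_.smul_pow, mul_smul, mul_smul,
    Nat.cast_smul_eq_nsmul, nsmul_eq_mul]

lemma coeff_le_coeff_one_add_mul_pow_mul {f : ℝ⟦X⟧} (hf : ∀ k, 0 ≤ PowerSeries.coeff k f)
    (hr : 0 ≤ r) (m k : ℕ) :
    PowerSeries.coeff k f ≤
      PowerSeries.coeff k ((1 + PowerSeries.C r * PowerSeries.X) ^ m * f) := by
  induction m generalizing k with
  | zero => rw [pow_zero, one_mul]
  | succ m ih =>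
    refine (ih k).trans ?_
    rw [pow_succ', mul_assoc, add_mul, one_mul, map_add, mul_assoc, PowerSeries.coeff_C_mul]
    refine le_add_of_nonneg_right (mul_nonneg hr ?_)
    cases k with
    | zero => rw [PowerSeries.coeff_zero_X_mul]
    | succ k =>
      rw [PowerSeries.coeff_succ_X_mul]
      exact (hf k).trans (ih k)

/-- The power series of `((1 + r z) / (1 - κ z)) ^ (m + 1)`. -/
def peakSeries (r κ : ℝ) (m : ℕ) : ℝ⟦X⟧ :=
  (1 + PowerSeries.C r * PowerSeries.X) ^ (m + 1) *
    PowerSeries.mk fun k => κ ^ k * ((m + k).choose m : ℝ)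

lemma peakSeries_mul (r κ : ℝ) (m : ℕ) :
    (1 - PowerSeries.C κ * PowerSeries.X) ^ (m + 1) * peakSeries r κ m =
      (1 + PowerSeries.C r * PowerSeries.X) ^ (m + 1) := by
  have h := congrArg (PowerSeries.rescale κ) (PowerSeries.mk_add_choose_mul_one_sub_pow_eq_one ℝ m)
  rw [map_mul, map_pow, map_sub, map_one, PowerSeries.rescale_X, PowerSeries.rescale_mk] at h
  rw [peakSeries, mul_left_comm, mul_comm _ (PowerSeries.mk _), h, mul_one]

lemma le_coeff_peakSeries (hr : 0 ≤ r) (hκ : 0 ≤ κ) (m k : ℕ) :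
    κ ^ k * ((k + m).choose m : ℝ) ≤ PowerSeries.coeff k (peakSeries r κ m) := by
  rw [add_comm k]
  refine le_trans (PowerSeries.coeff_mk k fun k => κ ^ k * ((m + k).choose m : ℝ)).ge
    (coeff_le_coeff_one_add_mul_pow_mul (fun k => ?_) hr (m + 1) k)
  rw [PowerSeries.coeff_mk]
  positivity

lemma half_le_pow_of_le (hκ : 1 - 1 / (2 * n) ≤ κ) {k : ℕ} (hk : k < n) : 1 / 2 ≤ κ ^ k := by
  have hn : (1 : ℝ) ≤ n := by exact_mod_cast (by omega : 1 ≤ n)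
  have hkn : (k : ℝ) * (1 / (2 * n)) ≤ 1 / 2 := by
    rw [mul_one_div, div_le_div_iff₀ (by positivity) two_pos]
    have : (k : ℝ) ≤ n := by exact_mod_cast hk.le
    linarith
  have hle : 1 / (2 * (n : ℝ)) ≤ 1 / 2 := one_div_le_one_div_of_le two_pos (by linarith)
  have h := one_add_mul_sub_le_pow (show -1 ≤ κ by linarith) k
  have : (k : ℝ) * (1 - κ) ≤ k * (1 / (2 * n)) := by
    gcongr
    linarith
  linarith

lemma pow_div_le_norm_toeplitz_peakSeries (hr : 0 ≤ r) (hn : 1 ≤ n)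
    (hκ : 1 - 1 / (2 * n) ≤ κ) (m : ℕ) :
    1 / 2 * (n : ℝ) ^ (m + 1) / (m + 2).factorial ≤
      ‖toeplitz n ((peakSeries r κ m).map Complex.ofRealHom)‖ := by
  have hn' : (1 : ℝ) ≤ n := by exact_mod_cast hn
  have hκ0 : 0 ≤ κ := by
    have : 1 / (2 * (n : ℝ)) ≤ 1 := (div_le_one (by positivity)).2 (by linarith)
    linarith
  refine pow_div_le_norm_toeplitz (by norm_num) fun k hk => ?_
  refine le_trans ?_ (le_coeff_peakSeries hr hκ0 m k)
  gcongr
  exact half_le_pow_of_le hκ hk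

lemma one_sub_smul_moebiusSeries_pow_mul (h : ρ * r ≠ 1) (m : ℕ) :
    (1 - (ρ : ℂ) • moebiusSeries r) ^ (m + 1) *
        (peakSeries r ((ρ - r) / (1 - ρ * r)) m).map Complex.ofRealHom =
      ((1 - ρ * r : ℝ) : ℂ) ^ (m + 1) • 1 := by
  set κ := (ρ - r) / (1 - ρ * r)
  set d : ℂ := ((1 - ρ * r : ℝ) : ℂ) with hd
  have hdκ : d * κ = ρ - r := by
    rw [hd, ← Complex.ofReal_mul, mul_div_cancel₀ _ (sub_ne_zero.2 h.symm), Complex.ofReal_sub]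
  set u : ℂ⟦X⟧ := 1 + PowerSeries.C (r : ℂ) * PowerSeries.X with hu
  set v : ℂ⟦X⟧ := 1 - PowerSeries.C (κ : ℂ) * PowerSeries.X
  set q := (peakSeries r κ m).map Complex.ofRealHom
  have hq : v ^ (m + 1) * q = u ^ (m + 1) := by
    have := congrArg (PowerSeries.map Complex.ofRealHom) (peakSeries_mul r κ m)
    simpa using this
  have hu0 : u ≠ 0 := fun h0 => by simpa [u] using congrArg PowerSeries.constantCoeff h0
  have hmul : (1 - (ρ : ℂ) • moebiusSeries r) * u = d • v := by
    have hb := moebiusSeries_mul (r : ℂ)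
    rw [Complex.conj_ofReal] at hb
    rw [sub_mul, one_mul, smul_mul_assoc, hb, smul_sub, PowerSeries.smul_eq_C_mul _ d,
      PowerSeries.smul_eq_C_mul _ d, ← mul_assoc, ← map_mul, hdκ, hd, hu,
      PowerSeries.smul_eq_C_mul]
    simp only [Complex.ofReal_sub, Complex.ofReal_mul, Complex.ofReal_one, map_sub, map_mul,
      map_one]
    ring
  refine mul_right_cancel₀ (pow_ne_zero (m + 1) hu0) ?_
  rw [mul_right_comm, ← mul_pow, hmul, _root_.smul_pow, smul_mul_assoc, hq, smul_mul_assoc,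
    one_mul]

lemma one_sub_smul_toeplitz_moebiusSeries_pow_mul (h : ρ * r ≠ 1) (m : ℕ) :
    (1 - (ρ : ℂ) • toeplitz n (moebiusSeries r)) ^ (m + 1) *
      (((1 - ρ * r : ℝ) : ℂ)⁻¹ ^ (m + 1) •
        toeplitz n ((peakSeries r ((ρ - r) / (1 - ρ * r)) m).map Complex.ofRealHom)) = 1 := by
  have hd : ((1 - ρ * r : ℝ) : ℂ) ^ (m + 1) ≠ 0 :=
    pow_ne_zero _ (Complex.ofReal_ne_zero.2 (sub_ne_zero.2 h.symm))
  have hseries := congrArg (toeplitz n) (one_sub_smul_moebiusSeries_pow_mul h m)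
  simp only [map_mul, map_pow, map_sub, map_one, map_smul] at hseries
  rw [mul_smul_comm, hseries, inv_pow, smul_smul, inv_mul_cancel₀ hd, one_smul]

lemma one_sub_inv_le_moebius (hn : 1 ≤ n) (hr0 : 0 ≤ r) (hr : r < 1)
    (hρ : 1 - ρ = (1 - r) / (4 * n)) : 1 - 1 / (2 * n) ≤ (ρ - r) / (1 - ρ * r) := by
  have : (1 : ℝ) ≤ n := by exact_mod_cast hn
  have hr1 : 0 < 1 - r := by linarith
  have hρ1 : 0 < 1 - ρ := hρ ▸ by positivity
  have hle : 1 - r ≤ 1 - ρ * r := by nlinarith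
  have hsub : 1 - (ρ - r) / (1 - ρ * r) = (1 - ρ) * (1 + r) / (1 - ρ * r) := by
    rw [eq_div_iff (by linarith), sub_mul, div_mul_cancel₀ _ (by linarith)]
    ring
  have : (1 - ρ) * (1 + r) / (1 - ρ * r) ≤ 1 / (2 * n) := by
    calc (1 - ρ) * (1 + r) / (1 - ρ * r) ≤ (1 - ρ) * 2 / (1 - r) := by
          gcongr
          linarith
      _ = 1 / (2 * n) := by
          rw [hρ]
          field_simp
          norm_num
  linarith

lemma le_norm_funcCalc_peak (hn : 1 ≤ n) (hr0 : 0 ≤ r) (hr : r < 1) (hc : 0 ≤ c)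
    (hρ : 1 - ρ = (1 - r) / (4 * n)) (m : ℕ) :
    c / (2 ^ (m + 2) * (m + 2).factorial) * ((n : ℝ) / (1 - r)) ^ (m + 1) ≤
      ‖funcCalc (peak c ρ m) (toeplitz n (moebiusSeries r))‖ := by
  have hr1 : 0 < 1 - r := by linarith
  have hn' : (1 : ℝ) ≤ n := by exact_mod_cast hn
  have hle : (1 - r) / (4 * n) ≤ 1 - r := div_le_self hr1.le (by linarith)
  have hρ1 : 0 < 1 - ρ := hρ ▸ by positivity
  have hd0 : 0 < 1 - ρ * r := by nlinarith
  have hd : 1 - ρ * r ≤ 2 * (1 - r) := by nlinarith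
  have hr' : ‖(r : ℂ)‖ < 1 := by rwa [Complex.norm_real, Real.norm_of_nonneg hr0]
  rw [funcCalc_peak c (by linarith) (by linarith) (norm_toeplitz_moebiusSeries_le_one hr')
    (one_sub_smul_toeplitz_moebiusSeries_pow_mul (by linarith) m), norm_smul, norm_smul, norm_pow,
    norm_inv, Complex.norm_real, Complex.norm_real, Real.norm_of_nonneg hc,
    Real.norm_of_nonneg hd0.le]
  calc c / (2 ^ (m + 2) * (m + 2).factorial) * ((n : ℝ) / (1 - r)) ^ (m + 1)
      = c * ((2 * (1 - r))⁻¹ ^ (m + 1) * (1 / 2 * (n : ℝ) ^ (m + 1) / (m + 2).factorial)) := by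
        rw [div_pow, mul_inv, mul_pow, inv_pow, inv_pow]
        field_simp
        ring
    _ ≤ _ := by
        gcongr
        exact pow_div_le_norm_toeplitz_peakSeries hr0 hn (one_sub_inv_le_moebius hn hr0 hr hρ) m

/-- The extremal matrix is the disc automorphism of the nilpotent shift, whose only eigenvalue
is `r`. -/
lemma le_supPtakYoung {ν : (ℂ → ℂ) → ℝ≥0∞} (hn : 1 ≤ n) (hr0 : 0 ≤ r) (hr : r < 1) (hc : 0 ≤ c)
    (hρ : 1 - ρ = (1 - r) / (4 * n)) (hν : ν (peak c ρ m) ≤ 1) :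
    ENNReal.ofReal (c / (2 ^ (m + 2) * (m + 2).factorial) * ((n : ℝ) / (1 - r)) ^ (m + 1)) ≤
      supPtakYoung ν n r := by
  have hr1 : 0 < 1 - r := by linarith
  have hn' : (1 : ℝ) ≤ n := by exact_mod_cast hn
  have hle : (1 - r) / (4 * n) ≤ 1 - r := div_le_self hr1.le (by linarith)
  have hρ1 : 0 < 1 - ρ := hρ ▸ by positivity
  have hnorm : ‖(r : ℂ)‖ = r := by rw [Complex.norm_real, Real.norm_of_nonneg hr0]
  have hr' : ‖(r : ℂ)‖ < 1 := hnorm.trans_lt hr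
  refine le_trans ?_ (le_iSup₂_of_le (peak c ρ m)
    (differentiableOn_peak c (by linarith) (by linarith) m)
    (le_iSup₂_of_le hν (fun _ => (r : ℂ)) (le_iSup₂_of_le (fun _ => mem_ball_zero_iff.2 hr')
      (fun _ => hnorm.le) (le_iSup₂_of_le (toeplitz n (moebiusSeries r))
        (norm_toeplitz_moebiusSeries_le_one hr')
        (le_iSup_of_le (minpoly_toeplitz_moebiusSeries hr') le_rfl)))))
  rw [← ofReal_norm]
  exact ENNReal.ofReal_le_ofReal (le_norm_funcCalc_peak hn hr0 hr hc hρ m)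

end Peak

section PeakNorm

variable {p q β c s ρ : ℝ} {m : ℕ}

lemma circleAverage_inv_norm_one_sub_mul_sq {a : ℂ} (ha : ‖a‖ < 1) :
    Real.circleAverage (fun z => (‖1 - a * z‖ ^ 2)⁻¹) 0 1 = (1 - ‖a‖ ^ 2)⁻¹ := by
  have ha2 : 1 - ‖a‖ ^ 2 ≠ 0 := by nlinarith [norm_nonneg a]
  have hharm : InnerProductSpace.HarmonicOnNhd (fun _ : ℂ => (1 - ‖a‖ ^ 2)⁻¹)
      (Metric.closedBall 0 1) := fun z _ => InnerProductSpace.harmonicAt_const _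
  rw [← hharm.circleAverage_poissonKernel_smul
    (mem_ball_zero_iff.2 ((RCLike.norm_conj a).trans_lt ha))]
  refine Real.circleAverage_congr_sphere fun z hz => ?_
  rw [abs_one, mem_sphere_zero_iff_norm] at hz
  have hnorm : ‖1 - a * z‖ = ‖z - conj a‖ := by
    rw [← RCLike.norm_conj (z - conj a), map_sub, Complex.conj_conj, ← Complex.inv_eq_conj hz,
      ← one_mul ‖1 - a * z‖, ← inv_one, ← hz, ← norm_inv, ← norm_mul, mul_sub, mul_one,
      mul_left_comm, inv_mul_cancel₀ (norm_ne_zero_iff.1 (hz.trans_ne one_ne_zero)), mul_one]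
  simp only [Pi.smul_apply', poissonKernel_def, sub_zero, hz, hnorm, RCLike.norm_conj, one_pow,
    smul_eq_mul]
  field_simp

lemma one_sub_mul_norm_le (hρ0 : 0 ≤ ρ) (z : ℂ) : 1 - ρ * ‖z‖ ≤ ‖1 - ρ * z‖ := by
  have h := norm_sub_norm_le (1 : ℂ) (ρ * z)
  rwa [norm_one, norm_mul, Complex.norm_real, Real.norm_of_nonneg hρ0] at h

lemma norm_peak_rpow_le (hc : 0 ≤ c) (hρ0 : 0 ≤ ρ) (hm : 2 ≤ (m + 1) * p) {z : ℂ}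
    (hz : ρ * ‖z‖ < 1) :
    ‖peak c ρ m z‖ ^ p ≤
      c ^ p * (1 - ρ * ‖z‖) ^ (2 - (m + 1) * p) * (‖1 - ρ * z‖ ^ 2)⁻¹ := by
  have hz' : 0 < 1 - ρ * ‖z‖ := sub_pos.2 hz
  have hle := one_sub_mul_norm_le hρ0 z
  have hpos := hz'.trans_le hle
  calc ‖peak c ρ m z‖ ^ p = c ^ p * ‖1 - ρ * z‖ ^ (-((m + 1) * p)) := by
        rw [peak, norm_mul, Complex.norm_real, Real.norm_of_nonneg hc, norm_div, norm_one,
          norm_pow, Real.mul_rpow hc (by positivity), one_div, Real.inv_rpow (by positivity),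
          Real.rpow_neg hpos.le, Real.rpow_mul hpos.le]
        norm_cast
    _ = c ^ p * ‖1 - ρ * z‖ ^ (2 - (m + 1) * p) * (‖1 - ρ * z‖ ^ 2)⁻¹ := by
        rw [(by ring : -((m + 1) * p) = 2 - (m + 1) * p + (-2 : ℝ)), Real.rpow_add hpos,
          Real.rpow_neg hpos.le 2, Real.rpow_two, mul_assoc]
    _ ≤ c ^ p * (1 - ρ * ‖z‖) ^ (2 - (m + 1) * p) * (‖1 - ρ * z‖ ^ 2)⁻¹ := by
        gcongr ?_ * ?_ * _
        exact Real.rpow_le_rpow_of_nonpos hz' hle (by linarith)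

lemma circleMean_peak_le (hc : 0 ≤ c) (hρ0 : 0 ≤ ρ) (hρ : ρ < 1) (hp : 0 ≤ p)
    (hm : 2 ≤ (m + 1) * p) (hs0 : 0 ≤ s) (hs : s < 1) :
    circleMean p (peak c ρ m) s ≤
      ENNReal.ofReal (c ^ p * (1 - ρ * s) ^ (1 - (m + 1) * p)) := by
  have hρs : ρ * s < 1 := by nlinarith
  have hρs0 : 0 ≤ ρ * s := by positivity
  have hnorm : ‖(ρ * s : ℂ)‖ = ρ * s := by
    rw [← Complex.ofReal_mul, Complex.norm_real, Real.norm_of_nonneg hρs0]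
  have hpeak : ContinuousOn (peak c ρ m) (Metric.sphere 0 s) :=
    (differentiableOn_peak c hρ0 hρ m).continuousOn.mono
      (Metric.sphere_subset_ball hs)
  have hne : ∀ z ∈ Metric.sphere (0 : ℂ) s, ‖1 - ρ * z‖ ^ 2 ≠ 0 := fun z hz => by
    have := one_sub_mul_norm_le hρ0 z
    rw [mem_sphere_zero_iff_norm.1 hz] at this
    exact (pow_pos (by linarith) 2).ne'
  rw [circleMean_eq_ofReal_circleAverage hs0 hpeak hp]
  refine ENNReal.ofReal_le_ofReal ?_
  calc _ ≤ Real.circleAverage (fun z => (c ^ p * (1 - ρ * s) ^ (2 - (m + 1) * p)) •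
        (‖1 - ρ * z‖ ^ 2)⁻¹) 0 s := by
        refine Real.circleAverage_mono
          ((hpeak.norm.rpow_const fun _ _ => .inr hp).circleIntegrable hs0)
          (ContinuousOn.circleIntegrable hs0 (ContinuousOn.fun_const_smul
            (ContinuousOn.fun_inv₀ (by fun_prop) hne) _)) fun z hz => ?_
        rw [abs_of_nonneg hs0, mem_sphere_zero_iff_norm] at hz
        exact hz ▸ norm_peak_rpow_le hc hρ0 hm (hz ▸ hρs)
    _ = c ^ p * (1 - ρ * s) ^ (2 - (m + 1) * p) * (1 - (ρ * s) ^ 2)⁻¹ := by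
        rw [Real.circleAverage_fun_smul, Real.circleAverage_eq_circleAverage_zero_one]
        simp only [add_zero, ← mul_assoc]
        rw [circleAverage_inv_norm_one_sub_mul_sq (hnorm.trans_lt hρs), hnorm, smul_eq_mul,
          mul_assoc]
    _ ≤ c ^ p * (1 - ρ * s) ^ (2 - (m + 1) * p) * (1 - ρ * s)⁻¹ := by
        have : 0 < 1 - ρ * s := sub_pos.2 hρs
        gcongr
        nlinarith
    _ = c ^ p * (1 - ρ * s) ^ (1 - (m + 1) * p) := by
        have h1 : 0 < 1 - ρ * s := sub_pos.2 hρs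
        rw [mul_assoc, ← Real.rpow_neg_one, ← Real.rpow_add h1]
        ring_nf

lemma mul_rpow_sub_div_rpow (hp : p ≠ 0) {D : ℝ} (hD : 0 ≤ D) {δ : ℝ} (hδ : 0 ≤ δ) (e : ℝ) :
    (D ^ (1 / p) * δ ^ ((m : ℝ) + 1 - e / p)) ^ p = D * δ ^ ((m + 1) * p - e) := by
  rw [Real.mul_rpow (by positivity) (by positivity), ← Real.rpow_mul hD, ← Real.rpow_mul hδ,
    one_div_mul_cancel hp, Real.rpow_one, sub_mul, div_mul_cancel₀ _ hp]

lemma hardyNorm_peak_le_one (hρ0 : 0 ≤ ρ) (hρ : ρ < 1) (hp : 0 < p) (hm : 2 ≤ (m + 1) * p) :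
    hardyNorm p (peak ((1 - ρ) ^ ((m : ℝ) + 1 - 1 / p)) ρ m) ≤ 1 := by
  have h1ρ : 0 < 1 - ρ := sub_pos.2 hρ
  have hc : ((1 - ρ) ^ ((m : ℝ) + 1 - 1 / p)) ^ p = (1 - ρ) ^ ((m + 1) * p - 1) := by
    simpa only [Real.one_rpow, one_mul] using
      mul_rpow_sub_div_rpow hp.ne' zero_le_one h1ρ.le 1
  rw [hardyNorm_eq_iSup_circleMean]
  refine iSup₂_le fun s hs => (rpow_one_div_le_one_iff hp).2 ?_
  refine (circleMean_peak_le (by positivity) hρ0 hρ hp.le hm hs.1 hs.2).trans ?_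
  rw [ENNReal.ofReal_le_one, hc]
  calc (1 - ρ) ^ ((m + 1) * p - 1) * (1 - ρ * s) ^ (1 - (m + 1) * p)
      ≤ (1 - ρ) ^ ((m + 1) * p - 1) * (1 - ρ) ^ (1 - (m + 1) * p) := by
        gcongr ?_ * ?_
        exact Real.rpow_le_rpow_of_nonpos h1ρ (by nlinarith [hs.2]) (by linarith)
    _ = 1 := by rw [← Real.rpow_add h1ρ, sub_add_sub_cancel, sub_self, Real.rpow_zero]

lemma setLIntegral_Ioi_rpow {a : ℝ} (ha : a < -1) {δ : ℝ} (hδ : 0 < δ) :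
    ∫⁻ t in Set.Ioi δ, ENNReal.ofReal (t ^ a) = ENNReal.ofReal (δ ^ (a + 1) / (-(a + 1))) := by
  rw [← ofReal_integral_eq_lintegral_ofReal (integrableOn_Ioi_rpow_of_lt ha hδ)
    ((ae_restrict_iff' measurableSet_Ioi).2
      (.of_forall fun t ht => Real.rpow_nonneg (hδ.trans ht).le a)),
    integral_Ioi_rpow_of_lt ha hδ, div_neg, neg_div]

lemma setLIntegral_Ioi_rpow_mul_max_rpow (hβ : -1 < β) (hq : β + 1 < q) {δ : ℝ} (hδ : 0 < δ) :
    ∫⁻ t in Set.Ioi 0, ENNReal.ofReal (t ^ β) * ENNReal.ofReal (max δ t ^ (-q)) =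
      ENNReal.ofReal ((1 / (β + 1) + 1 / (q - (β + 1))) * δ ^ (β + 1 - q)) := by
  have hβ' : 0 < β + 1 := by linarith
  have : 0 < q - (β + 1) := by linarith
  have hnear : ∫⁻ t in Set.Ioo 0 δ, ENNReal.ofReal (t ^ β) * ENNReal.ofReal (max δ t ^ (-q)) =
      ENNReal.ofReal (1 / (β + 1) * δ ^ (β + 1 - q)) := by
    have hmax : ∀ t ∈ Set.Ioo 0 δ, ENNReal.ofReal (t ^ β) * ENNReal.ofReal (max δ t ^ (-q)) =
        ENNReal.ofReal (t ^ β) * ENNReal.ofReal (δ ^ (-q)) := fun t ht => by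
      rw [max_eq_left ht.2.le]
    rw [setLIntegral_congr_fun measurableSet_Ioo hmax,
      lintegral_mul_const' _ _ ENNReal.ofReal_ne_top, setLIntegral_Ioo_rpow hβ hδ.le,
      ← ENNReal.ofReal_mul (by positivity), sub_eq_add_neg, Real.rpow_add hδ (β + 1)]
    congr 1
    ring
  have hfar : ∫⁻ t in Set.Ioi δ, ENNReal.ofReal (t ^ β) * ENNReal.ofReal (max δ t ^ (-q)) =
      ENNReal.ofReal (1 / (q - (β + 1)) * δ ^ (β + 1 - q)) := by
    have hmax : ∀ t ∈ Set.Ioi δ, ENNReal.ofReal (t ^ β) * ENNReal.ofReal (max δ t ^ (-q)) =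
        ENNReal.ofReal (t ^ (β - q)) := fun t ht => by
      have ht0 : 0 < t := hδ.trans ht
      rw [max_eq_right (le_of_lt ht), ← ENNReal.ofReal_mul (by positivity),
        ← Real.rpow_add ht0, sub_eq_add_neg]
    rw [setLIntegral_congr_fun measurableSet_Ioi hmax,
      setLIntegral_Ioi_rpow (by linarith) hδ]
    ring_nf
  rw [← Set.Ioo_union_Ici_eq_Ioi hδ, lintegral_union measurableSet_Ici
    (Set.disjoint_left.2 fun t h h' => h.2.not_ge h'), setLIntegral_congr Ioi_ae_eq_Ici.symm,
    hnear, hfar, ← ENNReal.ofReal_add (by positivity) (by positivity), add_mul]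

lemma one_sub_mul_sqrt_rpow_le (hρ0 : 0 ≤ ρ) (hρ : ρ < 1) (hq : 0 ≤ q) {t : ℝ} (ht0 : 0 ≤ t)
    (ht : t ≤ 1) :
    (1 - ρ * √(1 - t)) ^ (-q) ≤ 2 ^ q * max (1 - ρ) t ^ (-q) := by
  have hsq := Real.sq_sqrt (sub_nonneg.2 ht)
  have hs0 := Real.sqrt_nonneg (1 - t)
  have hs1 : √(1 - t) ≤ 1 := Real.sqrt_le_one.2 (by linarith)
  have hmax : 0 < max (1 - ρ) t := lt_max_of_lt_left (sub_pos.2 hρ)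
  have hle : max (1 - ρ) t / 2 ≤ 1 - ρ * √(1 - t) := by
    rw [div_le_iff₀ two_pos]
    refine max_le ?_ ?_ <;> nlinarith
  calc (1 - ρ * √(1 - t)) ^ (-q) ≤ (max (1 - ρ) t / 2) ^ (-q) :=
        Real.rpow_le_rpow_of_nonpos (half_pos hmax) hle (neg_nonpos.2 hq)
    _ = 2 ^ q * max (1 - ρ) t ^ (-q) := by
        rw [Real.div_rpow hmax.le two_pos.le, Real.rpow_neg two_pos.le, div_inv_eq_mul, mul_comm]

/-- The normalizing constant of the test function in the Bergman space `A^p(β)`. -/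
def bergmanConst (p β : ℝ) (m : ℕ) : ℝ :=
  2 ^ ((m + 1) * p - 1) * (1 / (β + 1) + 1 / ((m + 1) * p - 1 - (β + 1)))

lemma bergmanConst_pos (hβ : -1 < β) (hm : 2 + β < (m + 1) * p) : 0 < bergmanConst p β m := by
  have h1 : 0 < β + 1 := by linarith
  have h2 : 0 < (m + 1) * p - 1 - (β + 1) := by linarith
  unfold bergmanConst
  positivity

lemma bergmanNorm_peak_le_one (hρ0 : 0 ≤ ρ) (hρ : ρ < 1) (hp : 0 < p) (hβ : -1 < β)
    (hm : 2 ≤ (m + 1) * p) (hmβ : 2 + β < (m + 1) * p) :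
    bergmanNorm p β (peak ((bergmanConst p β m)⁻¹ ^ (1 / p) *
      (1 - ρ) ^ ((m : ℝ) + 1 - (2 + β) / p)) ρ m) ≤ 1 := by
  have h1ρ : 0 < 1 - ρ := sub_pos.2 hρ
  set C := bergmanConst p β m with hC
  have hC0 : 0 < C := bergmanConst_pos hβ hmβ
  set c := C⁻¹ ^ (1 / p) * (1 - ρ) ^ ((m : ℝ) + 1 - (2 + β) / p)
  have hc : 0 ≤ c := by positivity
  set q := (m + 1) * p - 1 with hq
  rw [bergmanNorm_eq_lintegral_circleMean (differentiableOn_peak c hρ0 hρ m).continuousOn,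
    rpow_one_div_le_one_iff hp]
  calc _ ≤ ∫⁻ t in Set.Ioo (0 : ℝ) 1, ENNReal.ofReal (c ^ p * 2 ^ q) *
        (ENNReal.ofReal (t ^ β) * ENNReal.ofReal (max (1 - ρ) t ^ (-q))) := by
        refine setLIntegral_mono' measurableSet_Ioo fun t ht => ?_
        rw [mul_left_comm, ← ENNReal.ofReal_mul (by positivity)]
        gcongr
        have hs : √(1 - t) < 1 := (Real.sqrt_lt' one_pos).2 (by linarith [ht.1])
        refine (circleMean_peak_le hc hρ0 hρ hp.le hm (Real.sqrt_nonneg _) hs).trans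
          (ENNReal.ofReal_le_ofReal ?_)
        rw [(by ring : 1 - (m + 1) * p = -q), mul_assoc]
        gcongr
        exact one_sub_mul_sqrt_rpow_le hρ0 hρ (by linarith) ht.1.le ht.2.le
    _ ≤ ENNReal.ofReal (c ^ p * 2 ^ q) *
        ENNReal.ofReal ((1 / (β + 1) + 1 / (q - (β + 1))) * (1 - ρ) ^ (β + 1 - q)) := by
        rw [lintegral_const_mul' _ _ ENNReal.ofReal_ne_top,
          ← setLIntegral_Ioi_rpow_mul_max_rpow hβ (by linarith) h1ρ]
        gcongr
        exact Set.Ioo_subset_Ioi_self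
    _ = ENNReal.ofReal (c ^ p * (C * (1 - ρ) ^ (β + 1 - q))) := by
        rw [← ENNReal.ofReal_mul (by positivity), hC, bergmanConst, ← hq]
        ring_nf
    _ = 1 := by
        rw [mul_rpow_sub_div_rpow hp.ne' (by positivity) h1ρ.le, mul_mul_mul_comm,
          inv_mul_cancel₀ hC0.ne', one_mul, ← Real.rpow_add h1ρ, hq, sub_add_eq_add_sub]
        ring_nf
        rw [Real.rpow_zero, ENNReal.ofReal_one]

end PeakNorm

section LowerBounds

variable {n : ℕ} {r : ℝ}

lemma le_supPtakYoung_of_peak (hn : 1 ≤ n) (hr0 : 0 ≤ r) (hr : r < 1) {D e : ℝ} (hD : 0 ≤ D)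
    (m : ℕ) {ν : (ℂ → ℂ) → ℝ≥0∞}
    (hν : ∀ ρ : ℝ, 0 ≤ ρ → ρ < 1 → ν (peak (D * (1 - ρ) ^ ((m : ℝ) + 1 - e)) ρ m) ≤ 1) :
    ENNReal.ofReal (D * 4 ^ (e - (m + 1)) / (2 ^ (m + 2) * (m + 2).factorial) *
      ((n : ℝ) / (1 - r)) ^ e) ≤ supPtakYoung ν n r := by
  have hN1 := one_le_div_one_sub hn hr0 hr
  set N : ℝ := n / (1 - r) with hN
  have hN0 : 0 < N := by linarith
  have hinv : (4 * N)⁻¹ ≤ 1 := inv_le_one_of_one_le₀ (by linarith)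
  have hinv0 : 0 < (4 * N)⁻¹ := by positivity
  have hδ : 1 - (1 - (4 * N)⁻¹) = (1 - r) / (4 * n) := by
    rw [sub_sub_cancel, hN, ← mul_div_assoc, inv_div]
  refine le_trans (le_of_eq ?_) (le_supPtakYoung hn hr0 hr
    (mul_nonneg hD (Real.rpow_nonneg (by linarith) _)) hδ
    (hν (1 - (4 * N)⁻¹) (by linarith) (by linarith)))
  have hNe : N ^ e = N ^ (e - (m + 1)) * N ^ (m + 1) := by
    rw [← Real.rpow_natCast, ← Real.rpow_add hN0, Nat.cast_succ, sub_add_cancel]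
  rw [sub_sub_cancel, ← hN, Real.inv_rpow (by positivity), ← Real.rpow_neg (by positivity),
    neg_sub, Real.mul_rpow (by norm_num) hN0.le, hNe]
  ring_nf

lemma le_supPtakYoung_hardyNorm {p : ℝ} (hp : 1 ≤ p) (hn : 1 ≤ n) (hr0 : 0 ≤ r) (hr : r < 1) :
    ENNReal.ofReal (4 ^ (1 / p - 2) / 48 * ((n : ℝ) / (1 - r)) ^ (1 / p)) ≤
      supPtakYoung (hardyNorm p) n r := by
  refine le_trans (le_of_eq ?_) (le_supPtakYoung_of_peak hn hr0 hr zero_le_one 1 (e := 1 / p)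
    fun ρ hρ0 hρ => ?_)
  · norm_num [Nat.factorial]
  · rw [one_mul]
    exact hardyNorm_peak_le_one hρ0 hρ (by linarith) (by push_cast; linarith)

lemma exists_le_supPtakYoung_bergmanNorm {p β : ℝ} (hp : 1 ≤ p) (hβ : -1 < β) :
    ∃ a : ℝ, 0 < a ∧ ∀ (n : ℕ) (r : ℝ), 1 ≤ n → 0 ≤ r → r < 1 →
      ENNReal.ofReal (a * ((n : ℝ) / (1 - r)) ^ ((2 + β) / p)) ≤
        supPtakYoung (bergmanNorm p β) n r := by
  obtain ⟨m, hm⟩ := exists_nat_ge (2 + β)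
  have hmp : (m : ℝ) + 1 ≤ (m + 1) * p := le_mul_of_one_le_right (by positivity) hp
  have hD : 0 < (bergmanConst p β m)⁻¹ ^ (1 / p) :=
    Real.rpow_pos_of_pos (inv_pos.2 (bergmanConst_pos hβ (by linarith))) _
  exact ⟨_, by positivity, fun n r hn hr0 hr => le_supPtakYoung_of_peak hn hr0 hr hD.le m
    fun ρ hρ0 hρ => bergmanNorm_peak_le_one hρ0 hρ (by linarith) hβ (by linarith) (by linarith)⟩

end LowerBounds

end PtakYoung

end

theorem corollary2p2 :
    (∀ p : ℝ, 1 ≤ p → ∃ a b : ℝ, 0 < a ∧ 0 < b ∧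
      ∀ (n : ℕ) (r : ℝ), 1 ≤ n → 0 ≤ r → r < 1 →
        ENNReal.ofReal (a * ((n : ℝ) / (1 - r)) ^ (1 / p)) ≤
            PtakYoung.supPtakYoung (PtakYoung.hardyNorm p) n r ∧
          PtakYoung.supPtakYoung (PtakYoung.hardyNorm p) n r ≤
            ENNReal.ofReal (b * ((n : ℝ) / (1 - r)) ^ (1 / p))) ∧
    (∀ p β : ℝ, 1 ≤ p → -1 < β → ∃ a b : ℝ, 0 < a ∧ 0 < b ∧
      ∀ (n : ℕ) (r : ℝ), 1 ≤ n → 0 ≤ r → r < 1 →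
        ENNReal.ofReal (a * ((n : ℝ) / (1 - r)) ^ ((2 + β) / p)) ≤
            PtakYoung.supPtakYoung (PtakYoung.bergmanNorm p β) n r ∧
          PtakYoung.supPtakYoung (PtakYoung.bergmanNorm p β) n r ≤
            ENNReal.ofReal (b * ((n : ℝ) / (1 - r)) ^ ((2 + β) / p))) := by
  refine ⟨fun p hp => ⟨4 ^ (1 / p - 2) / 48, (√2 ^ p * 160) ^ (1 / p), by positivity,
    by positivity, fun n r hn hr0 hr => ⟨PtakYoung.le_supPtakYoung_hardyNorm hp hn hr0 hr,
      PtakYoung.supPtakYoung_hardyNorm_le hp hn hr0 hr⟩⟩, fun p β hp hβ => ?_⟩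
  obtain ⟨a, ha, hlower⟩ := PtakYoung.exists_le_supPtakYoung_bergmanNorm hp hβ
  have hβ1 : 0 < β + 1 := by linarith
  exact ⟨a, (√2 ^ p * 160 * ((β + 1) * 80 ^ (β + 1))) ^ (1 / p), ha, by positivity,
    fun n r hn hr0 hr => ⟨hlower n r hn hr0 hr,
      PtakYoung.supPtakYoung_bergmanNorm_le hp hβ hn hr0 hr⟩⟩
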